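/- **Theorem 4 (dynamic regret of POLA).** Let $R,G\in\mathbb{R}$. There is a constant $c$ depending only on $R$ and $G$ such that the following holds for every dimension $d$ and horizon $T$. *Setting.* Let $\mathcal{K}\subseteq\mathbb{R}^d$ be convex with $\mathbf 0\in\mathcal{K}\subseteq R\mathcal{B}=\{\mathbf x:\|\mathbf x\|_2\le R\}$. In round $t=1,\dots,T$ the learner plays $\mathbf x_t\in\mathcal K$ and then receives a loss $f_t:\mathcal K\to[0,1]$ that is $G$-Lipschitz over $\mathcal K$ and differentiable relative to $\mathcal K$ with gradient $\nabla f_t$, and that is convex: $f_t(\mathbf y)\ge f_t(\mathbf x)+\nabla f_t(\mathbf x)^\top(\mathbf y-\mathbf x)$ for all $\mathbf x,\mathbf y\in\mathcal K$. For each $\mathbf x\in\mathcal K$, $\nabla f_t(\mathbf x)$ lies in the linear span of $\mathcal K$ or satisfies $\|\nabla f_t(\mathbf x)\|_2\le G$ (this is automatic if $\mathcal K$ has an interior point). *Infeasible projection oracle.* For $\epsilon>0$ and $(\mathbf x_0,\mathbf y_0)\in\mathcal K\times\mathbb R^d$, $\mathcal O_{\rm IP}(\epsilon,\mathbf x_0,\mathbf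 y_0)$ is a pair $(\mathbf x,\tilde{\mathbf y})\in\mathcal K\times R\mathcal B$ with $\|\mathbf x-\tilde{\mathbf y}\|_2\le\sqrt{3\epsilon}$ and $\|\tilde{\mathbf y}-\mathbf z\|_2\le\|\mathbf y_0-\mathbf z\|_2$ for all $\mathbf z\in\mathcal K$. *Experts.* Let $\mathcal I$ be the set of intervals $[i2^k,(i+1)2^k-1]$ with integers $k\ge0$, $i\ge1$. For $I\in\mathcal I$ put $\eta=|I|^{-3/4}$, $\epsilon=\eta^{2/3}$, and let $B$ be $\eta^{-2/3}=|I|^{1/2}$ rounded down or up to an integer (the same choice for all intervals of one length). The expert $E_I$ splits $I$ into consecutive blocks of $B$ rounds (the last one possibly shorter), starts from an arbitrary $\mathbf x^{(1)}=\tilde{\mathbf y}^{(1)}\in\mathcal K$, proposes $\mathbf x_{t,I}=\mathbf x^{(m)}$ in every round $t$ of its $m$-th block, and after each complete block sets $(\mathbf x^{(m+1)},\tilde{\mathbf y}^{(m+1)})=\mathcal O_{\rm IP}\big(\epsilon,\mathbf x^{(m)},\tilde{\mathbf y}^{(m)}-\eta\sum_{r\in\text{block }m}\nabla f_r(\mathbf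 x^{(m)})\big)$. *Algorithm POLA.* Let $\mathcal A_t=\{I\in\mathcal I: t\in I\}$, $\Phi(R',C')=\exp([R']_+^2/(3C'))$ with $\Phi(0,0)=1$, and $w(R',C')=\tfrac12\big(\Phi(R'+1,C'+1)-\Phi(R'-1,C'+1)\big)$. All variables $R_{t,I},C_{t,I}$ start at $0$ when $I$ becomes active. In round $t$, POLA plays $$\mathbf x_t=\sum_{I\in\mathcal A_t}\frac{w(R_{t-1,I},C_{t-1,I})}{\sum_{J\in\mathcal A_t}w(R_{t-1,J},C_{t-1,J})}\,\mathbf x_{t,I},$$ and for $I\in\mathcal A_t$ sets $R_{t,I}=R_{t-1,I}+f_t(\mathbf x_t)-f_t(\mathbf x_{t,I})$ and $C_{t,I}=C_{t-1,I}+|f_t(\mathbf x_t)-f_t(\mathbf x_{t,I})|$. *Conclusion.* For all comparators $\mathbf u_1,\dots,\mathbf u_T\in\mathcal K$, with $P_T=\sum_{t=2}^T\|\mathbf u_{t-1}-\mathbf u_t\|_2$, $$\sum_{t=1}^T f_t(\mathbf x_t)-\sum_{t=1}^T f_t(\mathbf u_t)\le c\,T^{3/4}(1+P_T)^{1/4}.$$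 -/

import Mathlib

open scoped BigOperators

namespace POLA

noncomputable section

/-- An infeasible projection oracle over `K ⊆ R𝓑`: for every tolerance `ε > 0` and inputs
`(x₀, y₀) ∈ K × E` it returns `(x, ỹ) ∈ K × R𝓑` with `‖x - ỹ‖ ≤ √(3 ε)` and
`‖ỹ - z‖ ≤ ‖y₀ - z‖` for all `z ∈ K`. -/
def IsInfeasibleProjectionOracle {E : Type*} [NormedAddCommGroup E]
    (K : Set E) (R : ℝ) (O : ℝ → E → E → E × E) : Prop :=
  ∀ ε : ℝ, 0 < ε → ∀ x₀ ∈ K, ∀ y₀ : E,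
    (O ε x₀ y₀).1 ∈ K ∧
    (O ε x₀ y₀).2 ∈ Metric.closedBall (0 : E) R ∧
    ‖(O ε x₀ y₀).1 - (O ε x₀ y₀).2‖ ≤ Real.sqrt (3 * ε) ∧
    ∀ z ∈ K, ‖(O ε x₀ y₀).2 - z‖ ≤ ‖y₀ - z‖

/-- The pair `(x, ỹ)` maintained by BOGD_IP during each block, blocks being numbered from `0`.
`B` is the block size, `g r` is the gradient map of the loss of the `r`-th round (`r ≥ 1`) of the
run, `x₁` is the initial point. -/
def bogdState {E : Type*} [NormedAddCommGroup E] [InnerProductSpace ℝ E]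
    (O : ℝ → E → E → E × E) (η ε : ℝ) (B : ℕ) (x₁ : E) (g : ℕ → E → E) : ℕ → E × E
  | 0 => (x₁, x₁)
  | m + 1 =>
    let p := bogdState O η ε B x₁ g m
    O ε p.1 (p.2 - η • ∑ r ∈ Finset.Icc (m * B + 1) ((m + 1) * B), g r p.1)

/-- The action of BOGD_IP in the `r`-th round (`r ≥ 1`) of its run. -/
def bogdAction {E : Type*} [NormedAddCommGroup E] [InnerProductSpace ℝ E]
    (O : ℝ → E → E → E × E) (η ε : ℝ) (B : ℕ) (x₁ : E) (g : ℕ → E → E) (r : ℕ) : E :=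
  (bogdState O η ε B x₁ g ((r - 1) / B)).1

/-- A pair `I = (k, i)` with `i ≥ 1` stands for the geometric covering interval
`[i * 2 ^ k, (i + 1) * 2 ^ k - 1]` of length `2 ^ k`. The intervals that contain round `t`. -/
def activeIntervals (t : ℕ) : Finset (ℕ × ℕ) :=
  (Finset.range (t + 1) ×ˢ Finset.Icc 1 t).filter
    (fun I => I.2 * 2 ^ I.1 ≤ t ∧ t ≤ (I.2 + 1) * 2 ^ I.1 - 1)

/-- The bounds on `k` and `i` in `activeIntervals` exclude no interval. -/
theorem mem_activeIntervals (t k i : ℕ) :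
    (k, i) ∈ activeIntervals t ↔ 1 ≤ i ∧ i * 2 ^ k ≤ t ∧ t ≤ (i + 1) * 2 ^ k - 1 := by
  simp only [activeIntervals, Finset.mem_filter, Finset.mem_product, Finset.mem_range,
    Finset.mem_Icc]
  constructor
  · rintro ⟨⟨_, h1, _⟩, h2, h3⟩
    exact ⟨h1, h2, h3⟩
  · rintro ⟨h1, h2, h3⟩
    have hk : k < 2 ^ k := Nat.lt_two_pow_self
    have ha : 2 ^ k ≤ i * 2 ^ k := Nat.le_mul_of_pos_left _ h1
    have hb : i ≤ i * 2 ^ k := Nat.le_mul_of_pos_right _ (by positivity)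
    exact ⟨⟨by omega, h1, by omega⟩, h2, h3⟩

/-- The step size `η = |I|^(-3/4)` of the expert of an interval `I` of length `2 ^ k`. -/
def stepSize (k : ℕ) : ℝ := ((2 : ℝ) ^ k) ^ (-(3 / 4) : ℝ)

/-- The error tolerance `ε = η^(2/3)` of the expert of an interval of length `2 ^ k`. -/
def tolerance (k : ℕ) : ℝ := stepSize k ^ (2 / 3 : ℝ)

/-- `B k` is the value `η^(-2/3)`, rounded down or up to an integer, for the step size `η` of the
intervals of length `2 ^ k`. -/
def IsBlockSize (B : ℕ → ℕ) : Prop :=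
  ∀ k : ℕ, B k = ⌊stepSize k ^ (-(2 / 3) : ℝ)⌋₊ ∨ B k = ⌈stepSize k ^ (-(2 / 3) : ℝ)⌉₊

/-- The action in round `t` of the expert `E_I`, `I = (k, i)`: an instance of BOGD_IP which starts
in round `i * 2 ^ k` from the point `x₁ I`. Here `g t` is the gradient map of the loss of
round `t`. -/
def expertAction {E : Type*} [NormedAddCommGroup E] [InnerProductSpace ℝ E]
    (O : ℝ → E → E → E × E) (B : ℕ → ℕ) (x₁ : ℕ × ℕ → E) (g : ℕ → E → E)
    (I : ℕ × ℕ) (t : ℕ) : E :=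
  bogdAction O (stepSize I.1) (tolerance I.1) (B I.1) (x₁ I)
    (fun r => g (I.2 * 2 ^ I.1 + r - 1)) (t - I.2 * 2 ^ I.1 + 1)

/-- The AdaNormalHedge potential `Φ(R, C) = exp([R]₊² / (3 C))`; division by zero makes
`Φ(0, 0) = 1`. -/
def potential (R C : ℝ) : ℝ := Real.exp ((max 0 R) ^ 2 / (3 * C))

/-- The AdaNormalHedge weight function. -/
def weight (R C : ℝ) : ℝ := (potential (R + 1) (C + 1) - potential (R - 1) (C + 1)) / 2

/-- The weighted average of the actions of the active experts in round `t`, where `S I = (R, C)`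
holds the two variables of the expert `E_I` after round `t - 1`. -/
def weightedAction {E : Type*} [NormedAddCommGroup E] [InnerProductSpace ℝ E]
    (act : ℕ × ℕ → ℕ → E) (S : ℕ × ℕ → ℝ × ℝ) (t : ℕ) : E :=
  ∑ I ∈ activeIntervals t,
    (weight (S I).1 (S I).2 / ∑ J ∈ activeIntervals t, weight (S J).1 (S J).2) • act I t

/-- The variables `(R_{t,I}, C_{t,I})` of all experts after round `t`; they are zero until the
expert becomes active and stay constant after its interval has ended. -/
def metaState {E : Type*} [NormedAddCommGroup E] [InnerProductSpace ℝ E]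
    (f : ℕ → E → ℝ) (act : ℕ × ℕ → ℕ → E) : ℕ → (ℕ × ℕ → ℝ × ℝ)
  | 0 => fun _ => (0, 0)
  | t + 1 =>
    let S := metaState f act t
    let x := weightedAction act S (t + 1)
    fun I =>
      if I ∈ activeIntervals (t + 1) then
        ((S I).1 + (f (t + 1) x - f (t + 1) (act I (t + 1))),
          (S I).2 + |f (t + 1) x - f (t + 1) (act I (t + 1))|)
      else S I

/-- The action of POLA in round `t ≥ 1` on the losses `f 1, f 2, …` with gradient maps
`g 1, g 2, …`. -/
def action {E : Type*} [NormedAddCommGroup E] [InnerProductSpace ℝ E]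
    (O : ℝ → E → E → E × E) (B : ℕ → ℕ) (x₁ : ℕ × ℕ → E)
    (f : ℕ → E → ℝ) (g : ℕ → E → E) (t : ℕ) : E :=
  weightedAction (expertAction O B x₁ g) (metaState f (expertAction O B x₁ g) (t - 1)) t

/-- The dynamic regret over rounds `1, …, T` of the actions `x` against the comparators `u`. -/
def dynamicRegret {E : Type*} (f : ℕ → E → ℝ) (x u : ℕ → E) (T : ℕ) : ℝ :=
  ∑ t ∈ Finset.Icc 1 T, f t (x t) - ∑ t ∈ Finset.Icc 1 T, f t (u t)

/-- The path-length `P_T` of the comparators `u 1, …, u T`. -/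
def pathLength {E : Type*} [NormedAddCommGroup E] (u : ℕ → E) (T : ℕ) : ℝ :=
  ∑ t ∈ Finset.Icc 2 T, ‖u (t - 1) - u t‖

end

end POLA

/-!
Fix an interval length `L = 2 ^ k`. After the rounds `1, …, L - 1`, which the intervals
`[2 ^ j, 2 ^ (j + 1) - 1]` with `j < k` cover, the intervals of level `k` tile the time axis. On each
interval `I` of this cover, the regret splits into that of the expert `E_I` and that of the learner
against `E_I`.

*Experts.* The expert of an interval of length `L` has dynamic regret `O(L ^ (3 / 4) (1 + P_I))`
(`expert_regret_le`), by the usual analysis of online gradient descent over blocks: the iterates `ỹ`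
need not be feasible, as `‖ỹ - z‖ ≤ ‖y₀ - z‖` and `‖ỹ‖ ≤ R` suffice, and the distance of the action
to `ỹ` costs `√(3 ε)` per round. The gradients are bounded by `G` also at the boundary of `K`,
where `f` determines them on the span of `K` only (`norm_gradient_le`).

*Learner.* The drift of the AdaNormalHedge potential is at most a linear term, whose weighted sum
is nonpositive by the choice of the weights and convexity, plus a telescoping correction
(`potential_step_le`). Bounding the potential of a single expert by the total would cost a factor
`√(log T)`. It is avoided by bounding the sum of the potentials of *all* experts ever started, which
is `O(T)` (`sum_potential_sub_one_le`): the `T / L` experts of level `k` then have potential `O(L)`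
on average, and `R_I ≤ √(3 L log Φ_I)`, linearized in `Φ_I` (`regret_le_potential`), sums to
`O(T L ^ (-1 / 4))` over them.

Altogether the regret is `O(L ^ (3 / 4) (1 + P_T) + T L ^ (-1 / 4))` for every `L = 2 ^ k ≤ T`
(`regret_le_of_level`), and `L ≈ T / (1 + P_T)` gives the claim (`exists_level_le`).
-/

namespace POLA

/-! ### The potential of AdaNormalHedge -/

theorem one_le_potential {R C : ℝ} (hC : 0 ≤ C) : 1 ≤ potential R C :=
  Real.one_le_exp (by positivity)

theorem potential_of_nonpos {R C : ℝ} (hR : R ≤ 0) : potential R C = 1 := by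
  simp [potential, max_eq_left hR]

theorem potential_mono {R R' C : ℝ} (hC : 0 ≤ C) (h : R ≤ R') :
    potential R C ≤ potential R' C := by
  unfold potential
  have : max 0 R ≤ max 0 R' := max_le_max le_rfl h
  gcongr

theorem weight_nonneg {R C : ℝ} (hC : 0 ≤ C) : 0 ≤ weight R C := by
  have := potential_mono (R := R - 1) (R' := R + 1) (C := C + 1) (by linarith) (by linarith)
  unfold weight
  linarith

theorem weight_zero_pos : 0 < weight 0 0 := by
  have h : potential (0 - 1) (0 + 1) = 1 := potential_of_nonpos (by norm_num)
  have h' : 1 < potential (0 + 1) (0 + 1) := by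
    unfold potential
    rw [Real.one_lt_exp_iff]
    norm_num
  rw [weight, h]
  exact half_pos (sub_pos.2 h')

/-- Convexity of the potential along segments on which `C` grows at unit speed: the exponent is a
quadratic-over-linear function. -/
theorem potential_segment_le {R C σ s : ℝ} (hC : 0 ≤ C) (hRC : R ≤ C) (hs0 : 0 ≤ s) (hs1 : s ≤ 1) :
    potential (R + s * σ) (C + s) ≤ (1 - s) * potential R C + s * potential (R + σ) (C + 1) := by
  have key : (max 0 (R + s * σ)) ^ 2 / (3 * (C + s)) ≤
      (1 - s) * ((max 0 R) ^ 2 / (3 * C)) + s * ((max 0 (R + σ)) ^ 2 / (3 * (C + 1))) := by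
    set a := max 0 R with ha
    set b := max 0 (R + σ) with hb
    have ha0 : 0 ≤ a := le_max_left _ _
    have hb0 : 0 ≤ b := le_max_left _ _
    have hmax : max 0 (R + s * σ) ≤ (1 - s) * a + s * b := by
      refine max_le (by nlinarith) ?_
      have h1 : R ≤ a := le_max_right _ _
      have h2 : R + σ ≤ b := le_max_right _ _
      nlinarith
    have hsq : (max 0 (R + s * σ)) ^ 2 ≤ ((1 - s) * a + s * b) ^ 2 :=
      pow_le_pow_left₀ (le_max_left _ _) hmax 2
    rcases hs0.eq_or_lt with rfl | hs
    · simp [ha]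
    rcases hC.eq_or_lt with rfl | hC
    · have ha' : a = 0 := max_eq_left hRC
      rw [ha'] at hsq ⊢
      calc _ ≤ ((1 - s) * 0 + s * b) ^ 2 / (3 * (0 + s)) := by gcongr
        _ = _ := by field_simp; ring
    · calc _ ≤ ((1 - s) * a + s * b) ^ 2 / (3 * (C + s)) := by gcongr
        _ ≤ _ := by
          have h : (1 - s) * (a ^ 2 / (3 * C)) + s * (b ^ 2 / (3 * (C + 1))) -
              ((1 - s) * a + s * b) ^ 2 / (3 * (C + s)) =
              (1 - s) * s * (a * (C + 1) - b * C) ^ 2 / (3 * C * (C + 1) * (C + s)) := by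
            field_simp
            ring
          have h' : 0 ≤ (1 - s) * s * (a * (C + 1) - b * C) ^ 2 / (3 * C * (C + 1) * (C + s)) := by
            have : 0 ≤ 1 - s := by linarith
            positivity
          linarith
  calc potential (R + s * σ) (C + s)
      ≤ Real.exp ((1 - s) * ((max 0 R) ^ 2 / (3 * C)) +
          s * ((max 0 (R + σ)) ^ 2 / (3 * (C + 1)))) := Real.exp_le_exp.2 key
    _ ≤ _ := by
      have := convexOn_exp.2 (Set.mem_univ ((max 0 R) ^ 2 / (3 * C)))
        (Set.mem_univ ((max 0 (R + σ)) ^ 2 / (3 * (C + 1)))) (sub_nonneg.2 hs1) hs0 (by ring)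
      simpa [potential] using this

/-- A fair `±1` step of `R` raises the potential by `O(1 / (C + 1))` on average. For `R² ≥ 3 C` the
growth of `C` alone compensates; otherwise the potential is at most `e`. -/
theorem potential_average_le {R C : ℝ} (hC : 0 ≤ C) (hRC : R ≤ C) :
    (potential (R + 1) (C + 1) + potential (R - 1) (C + 1)) / 2 ≤
      potential R C + 2 / (C + 1) := by
  have hD : 0 < C + 1 := by linarith
  have hx1 : 1 / (3 * (C + 1)) ≤ 1 := by
    rw [div_le_one (by positivity)]; linarith
  have hexp : Real.exp (1 / (3 * (C + 1))) - 1 ≤ 2 * (1 / (3 * (C + 1))) := by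
    have h0 : 0 ≤ 1 / (3 * (C + 1)) := by positivity
    have := Real.abs_exp_sub_one_le (x := 1 / (3 * (C + 1))) (by rwa [abs_of_nonneg h0])
    rw [abs_of_nonneg h0] at this
    exact (le_abs_self _).trans this
  have h23 : 2 * (1 / (3 * (C + 1))) = (2 / 3) * (1 / (C + 1)) := by field_simp
  have hpos : 0 < 1 / (C + 1) := by positivity
  have h2 : 2 / (C + 1) = 2 * (1 / (C + 1)) := by ring
  rcases le_or_gt R 0 with hR | hR
  · have h1 : potential (R + 1) (C + 1) ≤ Real.exp (1 / (3 * (C + 1))) := by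
      refine (potential_mono hD.le (by linarith : R + 1 ≤ 1)).trans ?_
      simp [potential]
    rw [potential_of_nonpos hR, potential_of_nonpos (by linarith : R - 1 ≤ 0)]
    linarith
  · have hC' : 0 < C := hR.trans_le hRC
    have hsq : ∀ x : ℝ, potential x (C + 1) ≤ Real.exp (x ^ 2 / (3 * (C + 1))) := by
      intro x
      unfold potential
      have : (max 0 x) ^ 2 ≤ x ^ 2 := by
        rcases le_total 0 x with h | h
        · rw [max_eq_right h]
        · rw [max_eq_left h, zero_pow two_ne_zero]; exact sq_nonneg x
      gcongr
    have hΦ : potential R C = Real.exp (R ^ 2 / (3 * C)) := by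
      simp [potential, max_eq_right hR.le]
    have hcosh : (potential (R + 1) (C + 1) + potential (R - 1) (C + 1)) / 2 ≤
        Real.exp ((R ^ 2 + 1) / (3 * (C + 1)) + (2 * R / (3 * (C + 1))) ^ 2 / 2) := by
      calc _ ≤ (Real.exp ((R + 1) ^ 2 / (3 * (C + 1))) +
              Real.exp ((R - 1) ^ 2 / (3 * (C + 1)))) / 2 := by
            have := hsq (R + 1)
            have := hsq (R - 1)
            linarith
        _ = Real.exp ((R ^ 2 + 1) / (3 * (C + 1))) * Real.cosh (2 * R / (3 * (C + 1))) := by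
            have e1 : (R + 1) ^ 2 / (3 * (C + 1)) =
                (R ^ 2 + 1) / (3 * (C + 1)) + 2 * R / (3 * (C + 1)) := by ring
            have e2 : (R - 1) ^ 2 / (3 * (C + 1)) =
                (R ^ 2 + 1) / (3 * (C + 1)) + -(2 * R / (3 * (C + 1))) := by ring
            rw [Real.cosh_eq, e1, e2, Real.exp_add, Real.exp_add]
            ring
        _ ≤ _ := by
            rw [Real.exp_add]
            gcongr
            exact Real.cosh_le_exp_half_sq _
    have hgap : R ^ 2 / (3 * C) + 1 / (3 * (C + 1)) -
        ((R ^ 2 + 1) / (3 * (C + 1)) + (2 * R / (3 * (C + 1))) ^ 2 / 2) =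
        R ^ 2 * (C + 3) / (9 * C * (C + 1) ^ 2) := by
      field_simp
      ring
    rcases le_or_gt (3 * C) (R ^ 2) with h | h
    · have hle : (R ^ 2 + 1) / (3 * (C + 1)) + (2 * R / (3 * (C + 1))) ^ 2 / 2 ≤
          R ^ 2 / (3 * C) := by
        have : 1 / (3 * (C + 1)) ≤ R ^ 2 * (C + 3) / (9 * C * (C + 1) ^ 2) := by
          rw [div_le_div_iff₀ (by positivity) (by positivity)]
          nlinarith [mul_le_mul_of_nonneg_right h (by positivity : 0 ≤ (C + 3) * (C + 1)),
            mul_pos hC' hD]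
        linarith
      have := Real.exp_le_exp.2 hle
      rw [hΦ]
      linarith
    · have hle : (R ^ 2 + 1) / (3 * (C + 1)) + (2 * R / (3 * (C + 1))) ^ 2 / 2 ≤
          R ^ 2 / (3 * C) + 1 / (3 * (C + 1)) := by
        have : 0 ≤ R ^ 2 * (C + 3) / (9 * C * (C + 1) ^ 2) := by positivity
        linarith
      have h3 : potential R C ≤ 3 := by
        rw [hΦ]
        have : R ^ 2 / (3 * C) ≤ 1 := by
          rw [div_le_one (by positivity)]; exact h.le
        exact (Real.exp_le_exp.2 this).trans (Real.exp_one_lt_d9.le.trans (by norm_num))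
      have h4 := Real.exp_le_exp.2 hle
      rw [Real.exp_add (R ^ 2 / (3 * C)), ← hΦ] at h4
      have h5 : potential R C * (Real.exp (1 / (3 * (C + 1))) - 1) ≤
          3 * (2 * (1 / (3 * (C + 1)))) := by
        have : 0 ≤ Real.exp (1 / (3 * (C + 1))) - 1 := by
          have := Real.one_le_exp (x := 1 / (3 * (C + 1))) (by positivity)
          linarith
        gcongr
      linarith

/-- The drift bound of AdaNormalHedge: up to the linear term `weight R C * r` and a correction that
telescopes, the potential does not increase. -/
theorem potential_step_le {R C r : ℝ} (hC : 0 ≤ C) (hRC : R ≤ C) (hr : |r| ≤ 1) :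
    potential (R + r) (C + |r|) - 6 * √(1 + (C + |r|)) ≤
      potential R C - 6 * √(1 + C) + weight R C * r := by
  have havg := potential_average_le hC hRC
  have hr0 := abs_nonneg r
  have h1 : potential (R + r) (C + |r|) ≤
      potential R C + weight R C * r + |r| * (2 / (C + 1)) := by
    rcases le_total 0 r with h | h
    · rw [abs_of_nonneg h] at hr ⊢
      have := potential_segment_le (σ := 1) hC hRC h hr
      rw [mul_one] at this
      have := mul_le_mul_of_nonneg_left havg h
      unfold weight
      linarith
    · rw [abs_of_nonpos h] at hr ⊢
      have := potential_segment_le (σ := -1) hC hRC (neg_nonneg.2 h) hr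
      rw [mul_neg_one, neg_neg, ← sub_eq_add_neg R 1] at this
      have := mul_le_mul_of_nonneg_left havg (neg_nonneg.2 h)
      unfold weight
      linarith
  have h2 : |r| * (2 / (C + 1)) ≤ 6 * √(1 + (C + |r|)) - 6 * √(1 + C) := by
    set a := √(1 + C)
    set b := √(1 + (C + |r|))
    have ha : a ^ 2 = 1 + C := Real.sq_sqrt (by linarith)
    have hb : b ^ 2 = 1 + (C + |r|) := Real.sq_sqrt (by linarith)
    have ha1 : 1 ≤ a := Real.one_le_sqrt.2 (by linarith)
    have hab : a ≤ b := Real.sqrt_le_sqrt (by linarith)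
    have hb2 : b ≤ 2 * a := by nlinarith
    have hr' : |r| = (b - a) * (b + a) := by linarith [sq_sub_sq b a]
    have : C + 1 = a ^ 2 := by linarith
    rw [this, mul_div_assoc', div_le_iff₀ (by positivity), hr']
    have : 0 ≤ (b - a) * (6 * a ^ 2 - 2 * (b + a)) :=
      mul_nonneg (by linarith) (by nlinarith)
    nlinarith
  linarith

/-- A bound on `R` by the potential, with `l ^ 4` in the role of the length of the interval: it is
`R ≤ √(3 C log Φ)`, linearized so that it can be summed over experts of equal length. -/
theorem regret_le_potential {R C l : ℝ} (hl : 1 ≤ l) (hRC : R ≤ C) (hCl : C ≤ l ^ 4) :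
    R ≤ 3 * l ^ 3 + potential R C / l ^ 3 := by
  have hΦ : 0 < potential R C := Real.exp_pos _
  have hl0 : 0 < l := by linarith
  rcases le_or_gt R 0 with hR | hR
  · have : 0 ≤ 3 * l ^ 3 + potential R C / l ^ 3 := by positivity
    linarith
  have hC : 0 < C := hR.trans_le hRC
  set q := R ^ 2 / (3 * C) with hq
  have hlog : q = Real.log (potential R C) := by
    simp [potential, max_eq_right hR.le, hq]
  have hq' : q ≤ potential R C / l ^ 4 + 2 * l ^ 2 := by
    have h1 := Real.log_le_sub_one_of_pos (x := potential R C / l ^ 4) (by positivity)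
    have h2 := Real.log_le_sub_one_of_pos (x := l ^ 2) (by positivity)
    rw [Real.log_div hΦ.ne' (by positivity), ← hlog, show l ^ 4 = (l ^ 2) ^ 2 by ring,
      Real.log_pow] at h1
    rw [show l ^ 4 = (l ^ 2) ^ 2 by ring]
    push_cast at h1
    linarith
  have hamgm : 2 * R ≤ 3 * C / l + q * l := by
    have : 3 * C / l + q * l - 2 * R = (3 * C - l * R) ^ 2 / (3 * C * l) := by
      rw [hq]; field_simp; ring
    have : 0 ≤ (3 * C - l * R) ^ 2 / (3 * C * l) := by positivity
    linarith
  have h1 : 3 * C / l ≤ 3 * l ^ 3 := by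
    rw [div_le_iff₀ hl0]; nlinarith
  have h2 : q * l ≤ potential R C / l ^ 3 + 2 * l ^ 3 := by
    calc q * l ≤ (potential R C / l ^ 4 + 2 * l ^ 2) * l := by gcongr
      _ = _ := by field_simp
  have h3 : 0 ≤ potential R C / l ^ 3 := by positivity
  have h4 : 0 ≤ l ^ 3 := by positivity
  linarith

/-! ### Gradients relative to a convex set -/

/-- The span of a convex set containing the origin consists of the scaled differences of its
points. -/
theorem exists_smul_sub_of_mem_span {E : Type*} [AddCommGroup E] [Module ℝ E] {K : Set E}
    (hK : Convex ℝ K) (h0 : (0 : E) ∈ K) {v : E} (hv : v ∈ Submodule.span ℝ K) :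
    ∃ c : ℝ, 0 ≤ c ∧ ∃ y ∈ K, ∃ z ∈ K, v = c • (y - z) := by
  induction hv using Submodule.span_induction with
  | mem x hx => exact ⟨1, zero_le_one, x, hx, 0, h0, by simp⟩
  | zero => exact ⟨0, le_rfl, 0, h0, 0, h0, by simp⟩
  | add v w _ _ hv hw =>
    obtain ⟨a, ha, y, hy, z, hz, rfl⟩ := hv
    obtain ⟨b, hb, y', hy', z', hz', rfl⟩ := hw
    rcases (add_nonneg ha hb).eq_or_lt with h | h
    · obtain rfl : a = 0 := by linarith
      obtain rfl : b = 0 := by linarith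
      exact ⟨0, le_rfl, 0, h0, 0, h0, by simp⟩
    · have hsum : a / (a + b) + b / (a + b) = 1 := by field_simp
      refine ⟨a + b, h.le, _, hK hy hy' (by positivity) (by positivity) hsum,
        _, hK hz hz' (by positivity) (by positivity) hsum, ?_⟩
      have e1 : (a + b) * (a / (a + b)) = a := by field_simp
      have e2 : (a + b) * (b / (a + b)) = b := by field_simp
      simp only [smul_sub, smul_add, smul_smul, e1, e2]
      abel
  | smul r v _ hv =>
    obtain ⟨a, ha, y, hy, z, hz, rfl⟩ := hv
    rcases le_total 0 r with h | h
    · exact ⟨r * a, mul_nonneg h ha, y, hy, z, hz, by rw [smul_smul]⟩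
    · refine ⟨-r * a, mul_nonneg (neg_nonneg.2 h) ha, z, hz, y, hy, ?_⟩
      rw [smul_smul, neg_mul, neg_smul, ← smul_neg, neg_sub]

section Gradient

variable {E : Type*} [NormedAddCommGroup E] [InnerProductSpace ℝ E] [CompleteSpace E]

/-- At every point `x` of `K`, also on the boundary, the gradient of a `G`-Lipschitz function
relative to `K` is bounded by `G` on differences of points of `K`: compare the values at
`x + s (y - x)` and `x + s (z - x)` as `s → 0`. -/
theorem inner_gradient_sub_le {K : Set E} (hK : Convex ℝ K) {f : E → ℝ} {v x : E} {G : ℝ}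
    (hx : x ∈ K) (hf : HasGradientWithinAt f v K x)
    (hlip : ∀ x ∈ K, ∀ y ∈ K, |f x - f y| ≤ G * ‖x - y‖) {y z : E} (hy : y ∈ K) (hz : z ∈ K) :
    inner ℝ v (y - z) ≤ G * ‖y - z‖ := by
  have hmem : ∀ y ∈ K, ∀ s ∈ Set.Icc (0 : ℝ) 1, x + s • (y - x) ∈ K := fun y hy s hs =>
    hK.add_smul_sub_mem hx hy hs
  have hder : ∀ y ∈ K, HasDerivWithinAt (fun s : ℝ => f (x + s • (y - x)))
      (inner ℝ v (y - x)) (Set.Icc 0 1) 0 := by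
    intro y hy
    have hγ : HasDerivWithinAt (fun s : ℝ => x + s • (y - x)) (y - x) (Set.Icc 0 1) 0 := by
      simpa using (((hasDerivAt_id (0 : ℝ)).smul_const (y - x)).const_add x).hasDerivWithinAt
    have hf' : HasFDerivWithinAt f (InnerProductSpace.toDual ℝ E v) K (x + (0 : ℝ) • (y - x)) := by
      simpa using hf.hasFDerivWithinAt
    have := hf'.comp_hasDerivWithinAt (0 : ℝ) hγ (fun s hs => hmem y hy s hs)
    rwa [InnerProductSpace.toDual_apply_apply] at this
  have hd := (hder y hy).sub (hder z hz)
  rw [← inner_sub_right, sub_sub_sub_cancel_right] at hd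
  have hd' := (hd.mono (t := Set.Icc 0 1) (s := Set.Ioc 0 1) Set.Ioc_subset_Icc_self)
  rw [hasDerivWithinAt_iff_tendsto_slope' (by simp)] at hd'
  have : (nhdsWithin (0 : ℝ) (Set.Ioc 0 1)).NeBot := by
    rw [nhdsWithin_Ioc_eq_nhdsGT one_pos]; infer_instance
  refine le_of_tendsto hd' ?_
  filter_upwards [self_mem_nhdsWithin] with s hs
  have hs' : s ∈ Set.Icc (0 : ℝ) 1 := Set.Ioc_subset_Icc_self hs
  have h := hlip _ (hmem y hy s hs') _ (hmem z hz s hs')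
  have e : x + s • (y - x) - (x + s • (z - x)) = s • (y - z) := by
    simp only [smul_sub]; abel
  rw [e, norm_smul, Real.norm_eq_abs, abs_of_pos hs.1] at h
  simp only [slope_def_field, Pi.sub_apply, zero_smul, sub_self, sub_zero]
  rw [div_le_iff₀ hs.1]
  linarith [le_abs_self (f (x + s • (y - x)) - f (x + s • (z - x)))]

theorem norm_gradient_le {K : Set E} (hK : Convex ℝ K) (h0 : (0 : E) ∈ K) {f : E → ℝ} {v x : E}
    {G : ℝ} (hx : x ∈ K) (hf : HasGradientWithinAt f v K x)
    (hlip : ∀ x ∈ K, ∀ y ∈ K, |f x - f y| ≤ G * ‖x - y‖)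
    (hv : v ∈ Submodule.span ℝ K ∨ ‖v‖ ≤ G) : ‖v‖ ≤ max G 0 := by
  rcases hv with hv | hv
  · obtain ⟨c, hc, y, hy, z, hz, hvc⟩ := exists_smul_sub_of_mem_span hK h0 hv
    have h1 : ‖v‖ * ‖v‖ ≤ G * ‖v‖ := by
      rw [← real_inner_self_eq_norm_mul_norm]
      nth_rw 2 [hvc]
      rw [inner_smul_right, hvc, norm_smul, ← hvc, Real.norm_eq_abs, abs_of_nonneg hc]
      have := mul_le_mul_of_nonneg_left (inner_gradient_sub_le hK hx hf hlip hy hz) hc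
      linarith
    rcases (norm_nonneg v).eq_or_lt with h | h
    · rw [← h]; exact le_max_right _ _
    · exact (le_of_mul_le_mul_right h1 h).trans (le_max_left _ _)
  · exact hv.trans (le_max_left _ _)

end Gradient

/-! ### Dynamic regret of an expert -/

/-- The fourth root `2 ^ (k / 4)` of the length of an interval of level `k`. All parameters of the
algorithm are powers of it. -/
noncomputable def quarticRoot (k : ℕ) : ℝ := ((2 : ℝ) ^ (1 / 4 : ℝ)) ^ k

theorem quarticRoot_pow_four (k : ℕ) : quarticRoot k ^ 4 = 2 ^ k := by
  have h : ((2 : ℝ) ^ (1 / 4 : ℝ)) ^ 4 = 2 := by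
    rw [← Real.rpow_natCast, ← Real.rpow_mul (by norm_num)]
    norm_num
  rw [quarticRoot, ← pow_mul, mul_comm, pow_mul, h]

theorem one_le_quarticRoot (k : ℕ) : 1 ≤ quarticRoot k :=
  one_le_pow₀ (Real.one_le_rpow (by norm_num) (by norm_num))

theorem quarticRoot_pos (k : ℕ) : 0 < quarticRoot k :=
  zero_lt_one.trans_le (one_le_quarticRoot k)

theorem quarticRoot_rpow (k n : ℕ) :
    (quarticRoot k ^ 4) ^ (n / 4 : ℝ) = quarticRoot k ^ n := by
  rw [← Real.rpow_natCast, ← Real.rpow_mul (quarticRoot_pos k).le, ← Real.rpow_natCast]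
  congr 1
  push_cast
  ring

theorem stepSize_eq (k : ℕ) : stepSize k = (quarticRoot k ^ 3)⁻¹ := by
  have := quarticRoot_rpow k 3
  rw [stepSize, ← quarticRoot_pow_four, Real.rpow_neg (by have := quarticRoot_pos k; positivity),
    ← this]
  norm_num

theorem stepSize_rpow (k : ℕ) : stepSize k ^ (2 / 3 : ℝ) = (quarticRoot k ^ 2)⁻¹ := by
  have h := quarticRoot_pos k
  rw [stepSize_eq, Real.inv_rpow (by positivity), ← Real.rpow_natCast, ← Real.rpow_mul h.le,
    ← Real.rpow_natCast]
  norm_num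

theorem tolerance_eq (k : ℕ) : tolerance k = (quarticRoot k ^ 2)⁻¹ := stepSize_rpow k

theorem blockSize_bounds {B : ℕ → ℕ} (hB : IsBlockSize B) (k : ℕ) :
    0 < B k ∧ (B k : ℝ) ≤ 2 * quarticRoot k ^ 2 := by
  have h1 : 1 ≤ quarticRoot k ^ 2 := one_le_pow₀ (one_le_quarticRoot k)
  have h : stepSize k ^ (-(2 / 3) : ℝ) = quarticRoot k ^ 2 := by
    have : 0 ≤ stepSize k := by unfold stepSize; positivity
    rw [Real.rpow_neg this, stepSize_rpow, inv_inv]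
  have hB := hB k
  rw [h] at hB
  rcases hB with hB | hB <;> rw [hB]
  · exact ⟨Nat.floor_pos.2 h1, (Nat.floor_le (by linarith)).trans (by linarith)⟩
  · exact ⟨Nat.ceil_pos.2 (by linarith), (Nat.ceil_lt_add_one (by linarith)).le.trans (by linarith)⟩

section ExpertRegret

variable {E : Type*} [NormedAddCommGroup E] [InnerProductSpace ℝ E]

/-- One online gradient step towards a nonexpansive (not necessarily feasible) projection `y'`,
with the comparator moving from `v` to `w` afterwards. -/
theorem inner_le_of_projection_step {R η N : ℝ} (hη : 0 < η) {a y y' v w : E}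
    (ha : ‖a‖ ≤ N) (hproj : ‖y' - v‖ ≤ ‖y - η • a - v‖)
    (hy' : ‖y'‖ ≤ R) (hv : ‖v‖ ≤ R) (hw : ‖w‖ ≤ R) :
    inner ℝ a (y - v) ≤ ‖y - v‖ ^ 2 / (2 * η) - ‖y' - w‖ ^ 2 / (2 * η) +
      2 * R / η * ‖v - w‖ + η * N ^ 2 / 2 := by
  have h1 : ‖y' - v‖ ^ 2 ≤ ‖y - v‖ ^ 2 - 2 * η * inner ℝ a (y - v) + η ^ 2 * N ^ 2 := by
    calc ‖y' - v‖ ^ 2 ≤ ‖y - η • a - v‖ ^ 2 := by gcongr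
      _ = ‖(y - v) - η • a‖ ^ 2 := by congr 2; abel
      _ = ‖y - v‖ ^ 2 - 2 * (η * inner ℝ a (y - v)) + η ^ 2 * ‖a‖ ^ 2 := by
        rw [norm_sub_sq_real, inner_smul_right, real_inner_comm, norm_smul, mul_pow,
          Real.norm_eq_abs, sq_abs]
      _ ≤ ‖y - v‖ ^ 2 - 2 * (η * inner ℝ a (y - v)) + η ^ 2 * N ^ 2 := by gcongr
      _ = _ := by ring
  have h2 : ‖y' - w‖ ^ 2 ≤ ‖y' - v‖ ^ 2 + 4 * R * ‖v - w‖ := by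
    have e1 : ‖y' - w‖ ≤ ‖y' - v‖ + ‖v - w‖ := norm_sub_le_norm_sub_add_norm_sub _ _ _
    have e2 : ‖y' - w‖ ≤ ‖y'‖ + ‖w‖ := norm_sub_le _ _
    have e3 : ‖y' - v‖ ≤ ‖y'‖ + ‖v‖ := norm_sub_le _ _
    nlinarith [norm_nonneg (y' - w), norm_nonneg (y' - v), norm_nonneg (v - w)]
  have e : ‖y - v‖ ^ 2 / (2 * η) - ‖y' - w‖ ^ 2 / (2 * η) + 2 * R / η * ‖v - w‖ + η * N ^ 2 / 2 -
      inner ℝ a (y - v) = (‖y - v‖ ^ 2 - ‖y' - w‖ ^ 2 + 4 * R * ‖v - w‖ + η ^ 2 * N ^ 2 -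
        2 * η * inner ℝ a (y - v)) / (2 * η) := by
    field_simp
    ring
  have : 0 ≤ (‖y - v‖ ^ 2 - ‖y' - w‖ ^ 2 + 4 * R * ‖v - w‖ + η ^ 2 * N ^ 2 -
        2 * η * inner ℝ a (y - v)) / (2 * η) := div_nonneg (by linarith) (by positivity)
  linarith

variable {K : Set E} {R : ℝ} {O : ℝ → E → E → E × E}

theorem bogdState_mem (hO : IsInfeasibleProjectionOracle K R O) {η ε : ℝ} (hε : 0 < ε) (B : ℕ)
    {x₁ : E} (hx₁ : x₁ ∈ K) (g : ℕ → E → E) (m : ℕ) :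
    (bogdState O η ε B x₁ g m).1 ∈ K := by
  induction m with
  | zero => exact hx₁
  | succ m ih => exact (hO ε hε _ ih _).1

theorem norm_bogdState_sub_le (hO : IsInfeasibleProjectionOracle K R O) {η ε : ℝ} (hε : 0 < ε)
    (B : ℕ) {x₁ : E} (hx₁ : x₁ ∈ K) (g : ℕ → E → E) (m : ℕ) :
    ‖(bogdState O η ε B x₁ g m).1 - (bogdState O η ε B x₁ g m).2‖ ≤ √(3 * ε) := by
  cases m with
  | zero => simp [bogdState]
  | succ m => exact (hO ε hε _ (bogdState_mem hO hε B hx₁ g m) _).2.2.1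

theorem bogdAction_block (η ε : ℝ) (B : ℕ) (x₁ : E) (g : ℕ → E → E) (m : ℕ) {j : ℕ} (hj : j < B) :
    bogdAction O η ε B x₁ g (m * B + j + 1) = (bogdState O η ε B x₁ g m).1 := by
  rw [bogdAction, Nat.add_sub_cancel, mul_comm, Nat.mul_add_div (by omega), Nat.div_eq_of_lt hj,
    add_zero]

/-- The linearized dynamic regret of `M` complete blocks. The round after `j` earlier ones is
compared with `u j`; the square of the distance of the iterate to the comparator at the beginning
of the block is the potential. -/
theorem bogd_linear_regret_le (hO : IsInfeasibleProjectionOracle K R O)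
    (hKR : K ⊆ Metric.closedBall (0 : E) R) {η ε : ℝ} (hη : 0 < η) (hε : 0 < ε) (B : ℕ)
    {x₁ : E} (hx₁ : x₁ ∈ K) {g : ℕ → E → E} {u : ℕ → E} (hu : ∀ j, u j ∈ K) {G : ℝ} (hG : 0 ≤ G)
    (M : ℕ) (hg : ∀ j < M * B, ∀ x ∈ K, ‖g (j + 1) x‖ ≤ G) :
    ∑ j ∈ Finset.range (M * B), inner ℝ (g (j + 1) (bogdAction O η ε B x₁ g (j + 1)))
        (bogdAction O η ε B x₁ g (j + 1) - u j) +
      ‖(bogdState O η ε B x₁ g M).2 - u (M * B)‖ ^ 2 / (2 * η) ≤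
    ‖x₁ - u 0‖ ^ 2 / (2 * η) +
      (2 * R / η + G * B) * ∑ j ∈ Finset.range (M * B), ‖u j - u (j + 1)‖ +
      M * (η * (G * B) ^ 2 / 2 + G * B * √(3 * ε)) := by
  have hR : ∀ {x : E}, x ∈ K → ‖x‖ ≤ R := fun hx => by simpa using hKR hx
  have hR0 : 0 ≤ R := (norm_nonneg _).trans (hR hx₁)
  induction M with
  | zero => simp [bogdState]
  | succ M ih =>
    have ih := ih fun j hj => hg j (hj.trans_le (Nat.mul_le_mul_right _ (Nat.le_succ M)))
    have hxK := bogdState_mem hO (η := η) hε B hx₁ g M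
    have hxy := norm_bogdState_sub_le hO (η := η) hε B hx₁ g M
    set p := bogdState O η ε B x₁ g M with hp
    set a := ∑ j ∈ Finset.range B, g (M * B + j + 1) p.1 with ha
    have hstate : bogdState O η ε B x₁ g (M + 1) = O ε p.1 (p.2 - η • a) := by
      rw [bogdState, ← hp, ha]
      congr 3
      rw [← Finset.Ico_add_one_right_eq_Icc, Finset.sum_Ico_eq_sum_range]
      refine Finset.sum_congr (by congr 1; rw [Nat.succ_mul]; omega) fun j _ => by
        congr 1; omega
    obtain ⟨-, hy', -, hproj⟩ := hO ε hε p.1 hxK (p.2 - η • a)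
    rw [← hstate] at hy' hproj
    have hblock : ∀ j ∈ Finset.range B, M * B + j < (M + 1) * B := fun j hj => by
      rw [Nat.succ_mul]; have := Finset.mem_range.1 hj; omega
    have hgB : ∀ j ∈ Finset.range B, ‖g (M * B + j + 1) p.1‖ ≤ G := fun j hj =>
      hg _ (hblock j hj) _ hxK
    have haN : ‖a‖ ≤ G * B := by
      refine (norm_sum_le_of_le _ hgB).trans (le_of_eq ?_)
      simp [mul_comm]
    set P := ∑ j ∈ Finset.range B, ‖u (M * B + j) - u (M * B + j + 1)‖ with hP
    have hdrift : ∀ j ≤ B, ‖u (M * B) - u (M * B + j)‖ ≤ P := by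
      intro j hj
      have := dist_le_range_sum_dist (fun i => u (M * B + i)) j
      simp only [dist_eq_norm] at this
      refine this.trans ?_
      exact Finset.sum_le_sum_of_subset_of_nonneg (Finset.range_mono hj)
        fun _ _ _ => norm_nonneg _
    have hB1 : (M + 1) * B = M * B + B := Nat.succ_mul _ _
    have hstep := inner_le_of_projection_step hη haN (hproj _ (hu (M * B)))
      (by simpa using hy') (hR (hu (M * B))) (hR (hu ((M + 1) * B)))
    have hPB : 2 * R / η * ‖u (M * B) - u ((M + 1) * B)‖ ≤ 2 * R / η * P := by
      rw [hB1]
      exact mul_le_mul_of_nonneg_left (hdrift B le_rfl) (by positivity)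
    have hlin : ∑ j ∈ Finset.range B, inner ℝ (g (M * B + j + 1) p.1) (p.1 - u (M * B + j)) ≤
        inner ℝ a (p.2 - u (M * B)) + G * B * √(3 * ε) + G * B * P := by
      have e : ∀ j, inner ℝ (g (M * B + j + 1) p.1) (p.1 - u (M * B + j)) =
          inner ℝ (g (M * B + j + 1) p.1) (p.2 - u (M * B)) +
          inner ℝ (g (M * B + j + 1) p.1) (p.1 - p.2) +
          inner ℝ (g (M * B + j + 1) p.1) (u (M * B) - u (M * B + j)) := by
        intro j
        rw [← inner_add_right, ← inner_add_right]
        congr 1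
        abel
      rw [Finset.sum_congr rfl fun j _ => e j, Finset.sum_add_distrib, Finset.sum_add_distrib,
        ← sum_inner, ← sum_inner, ← ha]
      have h1 : inner ℝ a (p.1 - p.2) ≤ G * B * √(3 * ε) :=
        (real_inner_le_norm _ _).trans (by gcongr)
      have h2 : ∑ j ∈ Finset.range B,
          inner ℝ (g (M * B + j + 1) p.1) (u (M * B) - u (M * B + j)) ≤ G * B * P := by
        calc _ ≤ ∑ j ∈ Finset.range B, G * P := by
              refine Finset.sum_le_sum fun j hj => (real_inner_le_norm _ _).trans ?_
              exact mul_le_mul (hgB j hj) (hdrift j (Finset.mem_range.1 hj).le)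
                (norm_nonneg _) hG
          _ = _ := by simp; ring
      linarith
    have hact : ∑ j ∈ Finset.range B,
        inner ℝ (g (M * B + j + 1) (bogdAction O η ε B x₁ g (M * B + j + 1)))
          (bogdAction O η ε B x₁ g (M * B + j + 1) - u (M * B + j)) =
        ∑ j ∈ Finset.range B, inner ℝ (g (M * B + j + 1) p.1) (p.1 - u (M * B + j)) :=
      Finset.sum_congr rfl fun j hj => by
        rw [bogdAction_block η ε B x₁ g M (Finset.mem_range.1 hj)]
    rw [hB1, Finset.sum_range_add, Finset.sum_range_add, hact, ← hP, ← hB1]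
    push_cast
    linarith

theorem expertAction_mem (hO : IsInfeasibleProjectionOracle K R O) (B : ℕ → ℕ)
    {x₁ : ℕ × ℕ → E} (hx₁ : ∀ I, x₁ I ∈ K) (g : ℕ → E → E) (I : ℕ × ℕ) (t : ℕ) :
    expertAction O B x₁ g I t ∈ K := by
  refine bogdState_mem hO ?_ _ (hx₁ I) _ _
  rw [tolerance_eq]
  have := quarticRoot_pos I.1
  positivity

/-- The dynamic regret of an expert over the first `n` rounds of its interval. The factor
`quarticRoot k ^ 3` is the power `3 / 4` of the length of the interval. -/
theorem expert_regret_le (hO : IsInfeasibleProjectionOracle K R O)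
    (hKR : K ⊆ Metric.closedBall (0 : E) R) {B : ℕ → ℕ} (hB : IsBlockSize B)
    {x₁ : ℕ × ℕ → E} (hx₁ : ∀ I, x₁ I ∈ K) {G : ℝ} (hG : 0 ≤ G) {f : ℕ → E → ℝ} {g : ℕ → E → E}
    {u : ℕ → E} (hu : ∀ t, u t ∈ K) (k i n : ℕ) (hn : n ≤ 2 ^ k)
    (hg : ∀ j < n, ∀ x ∈ K, ‖g (i * 2 ^ k + j) x‖ ≤ G)
    (hconv : ∀ j < n, ∀ x ∈ K, ∀ y ∈ K, f (i * 2 ^ k + j) y ≥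
      f (i * 2 ^ k + j) x + inner ℝ (g (i * 2 ^ k + j) x) (y - x))
    (hf : ∀ j < n, ∀ x ∈ K, 0 ≤ f (i * 2 ^ k + j) x ∧ f (i * 2 ^ k + j) x ≤ 1) :
    ∑ j ∈ Finset.range n, (f (i * 2 ^ k + j) (expertAction O B x₁ g (k, i) (i * 2 ^ k + j)) -
        f (i * 2 ^ k + j) (u (i * 2 ^ k + j))) ≤
      (2 * R ^ 2 + 2 * R + 4 * G + G ^ 2 + 2) * quarticRoot k ^ 3 *
        (1 + ∑ j ∈ Finset.range n, ‖u (i * 2 ^ k + j) - u (i * 2 ^ k + j + 1)‖) := by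
  obtain ⟨hB0, hB2⟩ := blockSize_bounds hB k
  have hl1 := one_le_quarticRoot k
  have hl4 := quarticRoot_pow_four k
  have hηl := stepSize_eq k
  have hεl := tolerance_eq k
  set l := quarticRoot k
  set s := i * 2 ^ k
  set b := B k
  have hl0 : 0 < l := by linarith
  have hη : 0 < stepSize k := by rw [hηl]; positivity
  have hε : 0 < tolerance k := by rw [hεl]; positivity
  have hR0 : 0 ≤ R := by
    have := hKR (hu 0)
    exact (norm_nonneg _).trans (by simpa using this)
  set M := n / b with hM
  have hMn : M * b ≤ n := Nat.div_mul_le_self n b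
  set act : ℕ → E := fun j => expertAction O B x₁ g (k, i) (s + j) with hact
  have hactK : ∀ j, act j ∈ K := fun j => expertAction_mem hO B hx₁ g (k, i) (s + j)
  have hact' : ∀ j, bogdAction O (stepSize k) (tolerance k) b (x₁ (k, i))
      (fun r => g (s + r - 1)) (j + 1) = act j := by
    intro j
    simp only [hact, expertAction]
    congr 1
    omega
  have hmain := bogd_linear_regret_le hO hKR hη hε b (hx₁ (k, i)) (g := fun r => g (s + r - 1))
    (u := fun j => u (s + j)) (fun j => hu _) hG M
    (fun j hj x hx => by simpa [← add_assoc] using hg j (hj.trans_le hMn) x hx)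
  simp only [hact', ← add_assoc, Nat.add_sub_cancel] at hmain
  set P := ∑ j ∈ Finset.range n, ‖u (s + j) - u (s + j + 1)‖ with hP
  have hP0 : 0 ≤ P := Finset.sum_nonneg fun _ _ => norm_nonneg _
  have hPM : ∑ j ∈ Finset.range (M * b), ‖u (s + j) - u (s + j + 1)‖ ≤ P :=
    Finset.sum_le_sum_of_subset_of_nonneg (Finset.range_mono hMn) fun _ _ _ => norm_nonneg _
  have hsplit : n = M * b + n % b := by rw [hM, mul_comm]; exact (Nat.div_add_mod n b).symm
  have hblocks : ∑ j ∈ Finset.range (M * b), (f (s + j) (act j) - f (s + j) (u (s + j))) ≤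
      ∑ j ∈ Finset.range (M * b), inner ℝ (g (s + j) (act j)) (act j - u (s + j)) := by
    refine Finset.sum_le_sum fun j hj => ?_
    have := hconv j ((Finset.mem_range.1 hj).trans_le hMn) _ (hactK j) _ (hu (s + j))
    rw [← neg_sub (act j), inner_neg_right] at this
    linarith
  have hrest : ∑ j ∈ Finset.range (n % b),
      (f (s + (M * b + j)) (act (M * b + j)) - f (s + (M * b + j)) (u (s + (M * b + j)))) ≤
      2 * l ^ 2 := by
    calc _ ≤ ∑ j ∈ Finset.range (n % b), (1 : ℝ) := by
          refine Finset.sum_le_sum fun j hj => ?_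
          have hj' : M * b + j < n := by have := Finset.mem_range.1 hj; omega
          have := (hf _ hj' _ (hactK (M * b + j))).2
          have := (hf _ hj' _ (hu (s + (M * b + j)))).1
          linarith
      _ = ((n % b : ℕ) : ℝ) := by simp
      _ ≤ b := by exact_mod_cast (Nat.mod_lt n hB0).le
      _ ≤ _ := hB2
  have hMb : (M : ℝ) * b ≤ l ^ 4 := by
    rw [hl4]; exact_mod_cast hMn.trans hn
  have hl23 : l ^ 2 ≤ l ^ 3 := pow_le_pow_right₀ hl1 (by norm_num)
  have hl3 : 0 < l ^ 3 := by positivity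
  have hinit : ‖x₁ (k, i) - u (s + 0)‖ ^ 2 / (2 * stepSize k) ≤ 2 * R ^ 2 * l ^ 3 := by
    have h1 : ‖x₁ (k, i)‖ ≤ R := by simpa using hKR (hx₁ (k, i))
    have h2 : ‖u (s + 0)‖ ≤ R := by simpa using hKR (hu (s + 0))
    have h3 : ‖x₁ (k, i) - u (s + 0)‖ ≤ 2 * R := (norm_sub_le _ _).trans (by linarith)
    calc _ ≤ (2 * R) ^ 2 / (2 * stepSize k) := by gcongr
      _ = _ := by rw [hηl]; field_simp
  have hpath : (2 * R / stepSize k + G * b) *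
      ∑ j ∈ Finset.range (M * b), ‖u (s + j) - u (s + j + 1)‖ ≤ (2 * R + 2 * G) * l ^ 3 * P := by
    have h1 : 2 * R / stepSize k + G * b ≤ (2 * R + 2 * G) * l ^ 3 := by
      have e1 : 2 * R / stepSize k = 2 * R * l ^ 3 := by rw [hηl]; field_simp
      have e2 : G * b ≤ G * (2 * l ^ 3) := by gcongr; linarith
      linarith
    exact mul_le_mul h1 hPM (Finset.sum_nonneg fun _ _ => norm_nonneg _) (by positivity)
  have hblk : (M : ℝ) * (stepSize k * (G * b) ^ 2 / 2 + G * b * √(3 * tolerance k)) ≤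
      (G ^ 2 + 2 * G) * l ^ 3 := by
    have hsq : √(3 * tolerance k) ≤ 2 / l := by
      rw [Real.sqrt_le_left (by positivity), hεl, div_pow]
      have : 0 < (l ^ 2)⁻¹ := by positivity
      rw [div_eq_mul_inv]
      nlinarith
    calc (M : ℝ) * (stepSize k * (G * b) ^ 2 / 2 + G * b * √(3 * tolerance k))
        = (M * b) * (stepSize k * G ^ 2 * b / 2 + G * √(3 * tolerance k)) := by ring
      _ ≤ l ^ 4 * (stepSize k * G ^ 2 * (2 * l ^ 2) / 2 + G * (2 / l)) := by gcongr
      _ = _ := by rw [hηl]; field_simp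
  have hdist : 0 ≤ ‖(bogdState O (stepSize k) (tolerance k) b (x₁ (k, i))
      (fun r => g (s + r - 1)) M).2 - u (s + M * b)‖ ^ 2 / (2 * stepSize k) := by positivity
  calc ∑ j ∈ Finset.range n, (f (s + j) (act j) - f (s + j) (u (s + j)))
      ≤ 2 * R ^ 2 * l ^ 3 + (2 * R + 2 * G) * l ^ 3 * P + (G ^ 2 + 2 * G) * l ^ 3 + 2 * l ^ 3 := by
        rw [hsplit, Finset.sum_range_add]
        linarith
    _ ≤ _ := by
        have h1 : 0 ≤ (2 * R + 2 * G) * l ^ 3 := by positivity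
        have h2 : 0 ≤ (2 * R ^ 2 + 2 * G + G ^ 2 + 2) * l ^ 3 * P := by positivity
        nlinarith

end ExpertRegret

/-! ### The total potential of the experts -/

section TotalPotential

variable {E : Type*} [NormedAddCommGroup E] [InnerProductSpace ℝ E]

variable {f : ℕ → E → ℝ} {act : ℕ × ℕ → ℕ → E}

/-- The regret of the learner against the expert of `I` in round `t`. -/
noncomputable def instantRegret (f : ℕ → E → ℝ) (act : ℕ × ℕ → ℕ → E) (I : ℕ × ℕ) (t : ℕ) : ℝ :=
  f t (weightedAction act (metaState f act (t - 1)) t) - f t (act I t)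

theorem metaState_succ_of_mem {t : ℕ} {I : ℕ × ℕ} (h : I ∈ activeIntervals (t + 1)) :
    metaState f act (t + 1) I = ((metaState f act t I).1 + instantRegret f act I (t + 1),
      (metaState f act t I).2 + |instantRegret f act I (t + 1)|) := by
  simp [metaState, h, instantRegret]

theorem metaState_succ_of_notMem {t : ℕ} {I : ℕ × ℕ} (h : I ∉ activeIntervals (t + 1)) :
    metaState f act (t + 1) I = metaState f act t I := by
  simp [metaState, h]

theorem metaState_fst_le_snd (t : ℕ) (I : ℕ × ℕ) :
    0 ≤ (metaState f act t I).2 ∧ (metaState f act t I).1 ≤ (metaState f act t I).2 := by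
  induction t with
  | zero => simp [metaState]
  | succ t ih =>
    by_cases h : I ∈ activeIntervals (t + 1)
    · rw [metaState_succ_of_mem h]
      exact ⟨add_nonneg ih.1 (abs_nonneg _), add_le_add ih.2 (le_abs_self _)⟩
    · rwa [metaState_succ_of_notMem h]

theorem filter_mem_activeIntervals (t k : ℕ) {i : ℕ} (hi : 1 ≤ i) :
    {s ∈ Finset.Ico 1 (t + 1) | (k, i) ∈ activeIntervals s} =
      Finset.Ico (i * 2 ^ k) (min ((i + 1) * 2 ^ k) (t + 1)) := by
  have h1 : 0 < 2 ^ k := by positivity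
  have h2 : 0 < i * 2 ^ k := by positivity
  have h3 : (i + 1) * 2 ^ k = i * 2 ^ k + 2 ^ k := Nat.succ_mul _ _
  ext s
  simp only [Finset.mem_filter, mem_activeIntervals, Finset.mem_Ico]
  omega

theorem metaState_eq_sum (t k : ℕ) {i : ℕ} (hi : 1 ≤ i) :
    metaState f act t (k, i) =
      (∑ s ∈ Finset.Ico (i * 2 ^ k) (min ((i + 1) * 2 ^ k) (t + 1)), instantRegret f act (k, i) s,
       ∑ s ∈ Finset.Ico (i * 2 ^ k) (min ((i + 1) * 2 ^ k) (t + 1)),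
        |instantRegret f act (k, i) s|) := by
  simp only [← filter_mem_activeIntervals t k hi, Finset.sum_filter]
  induction t with
  | zero => simp [metaState]
  | succ t ih =>
    rw [Finset.sum_Ico_succ_top (by omega : 1 ≤ t + 1),
      Finset.sum_Ico_succ_top (by omega : 1 ≤ t + 1)]
    by_cases h : (k, i) ∈ activeIntervals (t + 1)
    · rw [metaState_succ_of_mem h, ih]; simp [h]
    · rw [metaState_succ_of_notMem h, ih]; simp [h]

theorem metaState_eq_zero {t k i : ℕ} (hi : 1 ≤ i) (ht : t < i * 2 ^ k) :
    metaState f act t (k, i) = (0, 0) := by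
  rw [metaState_eq_sum t k hi, Finset.Ico_eq_empty_of_le (by omega)]
  simp

/-- The expert of the interval `{t}` has not been updated before round `t`, so that the weights do
not all vanish. -/
theorem sum_weight_pos (f : ℕ → E → ℝ) (act : ℕ × ℕ → ℕ → E) (t : ℕ) :
    0 < ∑ J ∈ activeIntervals (t + 1),
      weight (metaState f act t J).1 (metaState f act t J).2 := by
  refine Finset.sum_pos' (fun J _ => weight_nonneg (metaState_fst_le_snd t J).1)
    ⟨(0, t + 1), ?_, ?_⟩
  · simp [mem_activeIntervals]
  · rw [metaState_eq_zero (by omega) (by simp)]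
    exact weight_zero_pos

theorem weightedAction_mem {K : Set E} (hK : Convex ℝ K) (hact : ∀ I t, act I t ∈ K) (t : ℕ) :
    weightedAction act (metaState f act t) (t + 1) ∈ K := by
  have hW := sum_weight_pos f act t
  refine hK.sum_mem (fun J _ => ?_) ?_ fun J _ => hact J _
  · exact div_nonneg (weight_nonneg (metaState_fst_le_snd t J).1) hW.le
  · rw [← Finset.sum_div, div_self hW.ne']

/-- The learner's choice makes the linear term of the drift of the total potential nonpositive. -/
theorem sum_weight_mul_regret_nonpos {K : Set E} (hK : Convex ℝ K) (hact : ∀ I t, act I t ∈ K)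
    {t : ℕ} {g : E → E}
    (hconv : ∀ x ∈ K, ∀ y ∈ K, f (t + 1) y ≥ f (t + 1) x + inner ℝ (g x) (y - x)) :
    ∑ I ∈ activeIntervals (t + 1), weight (metaState f act t I).1 (metaState f act t I).2 *
      instantRegret f act I (t + 1) ≤ 0 := by
  have hW := sum_weight_pos f act t
  have hxK := weightedAction_mem (f := f) hK hact t
  set w : ℕ × ℕ → ℝ := fun I => weight (metaState f act t I).1 (metaState f act t I).2
  set W := ∑ J ∈ activeIntervals (t + 1), w J
  set x := weightedAction act (metaState f act t) (t + 1) with hx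
  have hWx : W • x = ∑ I ∈ activeIntervals (t + 1), w I • act I (t + 1) := by
    rw [hx, weightedAction, Finset.smul_sum]
    refine Finset.sum_congr rfl fun I _ => ?_
    rw [smul_smul]
    congr 1
    exact mul_div_cancel₀ _ hW.ne'
  calc _ ≤ ∑ I ∈ activeIntervals (t + 1), w I * inner ℝ (g x) (x - act I (t + 1)) := by
        refine Finset.sum_le_sum fun I _ => mul_le_mul_of_nonneg_left ?_
          (weight_nonneg (metaState_fst_le_snd t I).1)
        have := hconv x hxK _ (hact I (t + 1))
        rw [← neg_sub x, inner_neg_right] at this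
        have e : instantRegret f act I (t + 1) = f (t + 1) x - f (t + 1) (act I (t + 1)) := rfl
        linarith
    _ = inner ℝ (g x) (W • x - ∑ I ∈ activeIntervals (t + 1), w I • act I (t + 1)) := by
        rw [Finset.sum_smul, ← Finset.sum_sub_distrib, inner_sum]
        refine Finset.sum_congr rfl fun I _ => ?_
        rw [← smul_sub, inner_smul_right]
    _ = 0 := by rw [hWx, sub_self, inner_zero_right]
    _ ≤ 0 := le_rfl

theorem abs_instantRegret_le_one {K : Set E} (hK : Convex ℝ K) (hact : ∀ I t, act I t ∈ K)
    {t : ℕ} (ht : 1 ≤ t) (hf : ∀ x ∈ K, 0 ≤ f t x ∧ f t x ≤ 1) (I : ℕ × ℕ) :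
    |instantRegret f act I t| ≤ 1 := by
  obtain ⟨t, rfl⟩ := Nat.exists_eq_add_of_le' ht
  have h1 := hf _ (weightedAction_mem (f := f) hK hact t)
  have h2 := hf _ (hact I (t + 1))
  have e : instantRegret f act I (t + 1) = f (t + 1)
    (weightedAction act (metaState f act t) (t + 1)) - f (t + 1) (act I (t + 1)) := rfl
  rw [e, abs_le]
  constructor <;> linarith

/-- The drift bound summed over all experts. The box of indices contains every interval that starts
by round `T`; experts that are not active contribute no change, so that the set of summands may be
kept fixed. -/
theorem sum_potential_sub_le_zero {K : Set E} (hK : Convex ℝ K) (hact : ∀ I t, act I t ∈ K)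
    {T : ℕ} {g : ℕ → E → E}
    (hconv : ∀ t ∈ Finset.Icc 1 T, ∀ x ∈ K, ∀ y ∈ K, f t y ≥ f t x + inner ℝ (g t x) (y - x))
    (hf : ∀ t ∈ Finset.Icc 1 T, ∀ x ∈ K, 0 ≤ f t x ∧ f t x ≤ 1) {t : ℕ} (ht : t ≤ T) :
    ∑ I ∈ Finset.range (T + 1) ×ˢ Finset.Icc 1 T,
      (potential (metaState f act t I).1 (metaState f act t I).2 - 1 -
        6 * (√(1 + (metaState f act t I).2) - 1)) ≤ 0 := by
  induction t with
  | zero => simp [metaState, potential]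
  | succ t ih =>
    have ht' : t + 1 ∈ Finset.Icc 1 T := Finset.mem_Icc.2 ⟨by omega, ht⟩
    have hsub : activeIntervals (t + 1) ⊆ Finset.range (T + 1) ×ˢ Finset.Icc 1 T := by
      refine (Finset.filter_subset _ _).trans (Finset.product_subset_product ?_ ?_)
      · exact Finset.range_mono (by omega)
      · exact Finset.Icc_subset_Icc_right ht
    have hlin := sum_weight_mul_regret_nonpos (f := f) hK hact (hconv (t + 1) ht')
    rw [← Finset.inter_eq_right.2 hsub, ← Finset.sum_ite_mem] at hlin
    refine le_trans (Finset.sum_le_sum fun I _ => ?_) ((Finset.sum_add_distrib).trans_le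
      (add_nonpos (ih (by omega)) hlin))
    by_cases h : I ∈ activeIntervals (t + 1)
    · obtain ⟨h0, h1⟩ := metaState_fst_le_snd (f := f) (act := act) t I
      have := potential_step_le h0 h1
        (abs_instantRegret_le_one (f := f) hK hact (by omega) (hf _ ht') I)
      rw [metaState_succ_of_mem h, if_pos h]
      dsimp only
      linarith
    · rw [metaState_succ_of_notMem h, if_neg h, add_zero]

theorem metaState_snd_le {K : Set E} (hK : Convex ℝ K) (hact : ∀ I t, act I t ∈ K) {T : ℕ}
    (hf : ∀ t ∈ Finset.Icc 1 T, ∀ x ∈ K, 0 ≤ f t x ∧ f t x ≤ 1) {t : ℕ} (ht : t ≤ T)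
    (k : ℕ) {i : ℕ} (hi : 1 ≤ i) : (metaState f act t (k, i)).2 ≤ 2 ^ k := by
  have h1 : 0 < 2 ^ k := by positivity
  have h2 : 0 < i * 2 ^ k := by positivity
  have h3 : (i + 1) * 2 ^ k = i * 2 ^ k + 2 ^ k := Nat.succ_mul _ _
  rw [metaState_eq_sum t k hi]
  dsimp only
  calc _ ≤ ∑ s ∈ Finset.Ico (i * 2 ^ k) (min ((i + 1) * 2 ^ k) (t + 1)), (1 : ℝ) := by
        refine Finset.sum_le_sum fun s hs => ?_
        rw [Finset.mem_Ico] at hs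
        exact abs_instantRegret_le_one hK hact (by omega)
          (hf s (Finset.mem_Icc.2 (by omega))) _
    _ ≤ 2 ^ k := by
        simp only [Finset.sum_const, Nat.card_Ico, nsmul_eq_mul, mul_one]
        have h4 : min ((i + 1) * 2 ^ k) (t + 1) ≤ i * 2 ^ k + 2 ^ k := h3 ▸ min_le_left _ _
        exact_mod_cast (Nat.sub_le_iff_le_add'.2 h4 : min ((i + 1) * 2 ^ k) (t + 1) - i * 2 ^ k ≤ 2 ^ k)

theorem card_started_le (N t k : ℕ) :
    ((Finset.Icc 1 N).filter (fun i => i * 2 ^ k ≤ t)).card ≤ t / 2 ^ k := by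
  have : (Finset.Icc 1 N).filter (fun i => i * 2 ^ k ≤ t) ⊆ Finset.Icc 1 (t / 2 ^ k) := by
    intro i hi
    simp only [Finset.mem_filter, Finset.mem_Icc] at hi ⊢
    exact ⟨hi.1.1, (Nat.le_div_iff_mul_le (by positivity)).2 hi.2⟩
  simpa using Finset.card_le_card this

theorem sum_inv_quarticRoot_sq_le (n : ℕ) :
    ∑ k ∈ Finset.range n, (quarticRoot k ^ 2)⁻¹ ≤ 4 := by
  have h1 : quarticRoot 1 ^ 4 = 2 := by simpa using quarticRoot_pow_four 1
  have hpos := quarticRoot_pos 1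
  set r := (quarticRoot 1 ^ 2)⁻¹ with hr
  have hr0 : 0 < r := by positivity
  have hr2 : r ^ 2 = 1 / 2 := by
    rw [hr, inv_pow, ← pow_mul, h1]; norm_num
  have hr34 : r ≤ 3 / 4 := by nlinarith
  have e : ∀ k, (quarticRoot k ^ 2)⁻¹ = r ^ k := by
    intro k
    simp only [hr, quarticRoot, pow_one, inv_pow, ← pow_mul, mul_comm]
  simp only [e]
  have hgeom := mul_neg_geom_sum r n
  have : 0 < r ^ n := by positivity
  have h0 : 0 ≤ ∑ i ∈ Finset.range n, r ^ i := Finset.sum_nonneg fun _ _ => by positivity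
  nlinarith

/-- The potentials of all experts that have started by round `t`, finished ones included, add up to
`O(t)`: the `t / 2 ^ k` intervals of level `k` contribute `O(2 ^ (k / 2))` each. -/
theorem sum_potential_sub_one_le {K : Set E} (hK : Convex ℝ K) (hact : ∀ I t, act I t ∈ K)
    {T : ℕ} {g : ℕ → E → E}
    (hconv : ∀ t ∈ Finset.Icc 1 T, ∀ x ∈ K, ∀ y ∈ K, f t y ≥ f t x + inner ℝ (g t x) (y - x))
    (hf : ∀ t ∈ Finset.Icc 1 T, ∀ x ∈ K, 0 ≤ f t x ∧ f t x ≤ 1) {t : ℕ} (ht : t ≤ T) :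
    ∑ I ∈ Finset.range (T + 1) ×ˢ Finset.Icc 1 T,
      (potential (metaState f act t I).1 (metaState f act t I).2 - 1) ≤ 24 * t := by
  have h := sum_potential_sub_le_zero hK hact hconv hf ht
  rw [Finset.sum_sub_distrib, sub_nonpos] at h
  refine h.trans ?_
  rw [Finset.sum_product]
  calc _ ≤ ∑ k ∈ Finset.range (T + 1), 6 * t * (quarticRoot k ^ 2)⁻¹ := by
        refine Finset.sum_le_sum fun k _ => ?_
        have hl := quarticRoot_pos k
        calc _ ≤ ∑ i ∈ Finset.Icc 1 T, if i * 2 ^ k ≤ t then 6 * quarticRoot k ^ 2 else 0 := by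
              refine Finset.sum_le_sum fun i hi => ?_
              have hi1 := (Finset.mem_Icc.1 hi).1
              split_ifs with h
              · have hC0 := (metaState_fst_le_snd (f := f) (act := act) t (k, i)).1
                have hC := metaState_snd_le hK hact hf ht k hi1
                have : √(1 + (metaState f act t (k, i)).2) ≤ 1 + quarticRoot k ^ 2 := by
                  rw [Real.sqrt_le_left (by positivity)]
                  rw [← quarticRoot_pow_four] at hC
                  nlinarith [sq_nonneg (quarticRoot k)]
                linarith
              · rw [metaState_eq_zero hi1 (by omega)]; simp
          _ = ((Finset.Icc 1 T).filter (fun i => i * 2 ^ k ≤ t)).card * (6 * quarticRoot k ^ 2) := by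
              rw [← Finset.sum_filter]; simp
          _ ≤ (t / quarticRoot k ^ 4) * (6 * quarticRoot k ^ 2) := by
              gcongr
              have h1 : (((Finset.Icc 1 T).filter (fun i => i * 2 ^ k ≤ t)).card : ℝ) ≤
                ((t / 2 ^ k : ℕ) : ℝ) := by exact_mod_cast card_started_le T t k
              rw [quarticRoot_pow_four]
              refine h1.trans (Nat.cast_div_le.trans (by simp))
          _ = _ := by field_simp
    _ = 6 * t * ∑ k ∈ Finset.range (T + 1), (quarticRoot k ^ 2)⁻¹ := by rw [Finset.mul_sum]
    _ ≤ 6 * t * 4 := by gcongr; exact sum_inv_quarticRoot_sq_le _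
    _ = _ := by ring

end TotalPotential

/-! ### Combining the intervals -/

/-- The initial rounds `1, …, 2 ^ k - 1` are covered by the intervals `[2 ^ j, 2 ^ (j + 1) - 1]`, on
which bounds that grow geometrically with `j` add up to a multiple of the last one. -/
theorem sum_Ico_one_two_pow_le {h δ : ℕ → ℝ} {a b : ℝ} (ha : 0 ≤ a) (hb : 0 ≤ b)
    (hδ : ∀ t, 0 ≤ δ t) (k : ℕ)
    (H : ∀ j < k, ∑ t ∈ Finset.Ico (2 ^ j) (2 ^ (j + 1)), h t ≤
      a * quarticRoot j ^ 3 + b * quarticRoot j ^ 3 * ∑ t ∈ Finset.Ico (2 ^ j) (2 ^ (j + 1)), δ t) :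
    ∑ t ∈ Finset.Ico 1 (2 ^ k), h t ≤ 2 * a * quarticRoot k ^ 3 +
      b * quarticRoot k ^ 3 * ∑ t ∈ Finset.Ico 1 (2 ^ k), δ t := by
  induction k with
  | zero => simpa [quarticRoot] using ha
  | succ k ih =>
    have ih := ih fun j hj => H j (by omega)
    have hk := H k (by omega)
    have h1 : 1 ≤ 2 ^ k := Nat.one_le_two_pow
    have h2 : 2 ^ k ≤ 2 ^ (k + 1) := Nat.pow_le_pow_right (by norm_num) (by omega)
    rw [← Finset.sum_Ico_consecutive _ h1 h2, ← Finset.sum_Ico_consecutive _ h1 h2]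
    have hl : 0 < quarticRoot k ^ 3 := by have := quarticRoot_pos k; positivity
    have hr : 3 / 2 * quarticRoot k ^ 3 ≤ quarticRoot (k + 1) ^ 3 := by
      have hμ1 := one_le_quarticRoot 1
      have hμ4 : quarticRoot 1 ^ 4 = 2 := by simpa using quarticRoot_pow_four 1
      have hμ : 3 / 2 ≤ quarticRoot 1 ^ 3 := by
        refine le_of_pow_le_pow_left₀ four_ne_zero (by positivity) ?_
        rw [← pow_mul, mul_comm, pow_mul, hμ4]
        norm_num
      have e : quarticRoot (k + 1) = quarticRoot 1 * quarticRoot k := by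
        simp only [quarticRoot, pow_succ, pow_zero, one_mul, mul_comm]
      rw [e, mul_pow]
      gcongr
    set A := ∑ t ∈ Finset.Ico 1 (2 ^ k), δ t
    set D := ∑ t ∈ Finset.Ico (2 ^ k) (2 ^ (k + 1)), δ t
    have hA : 0 ≤ A := Finset.sum_nonneg fun _ _ => hδ _
    have hD : 0 ≤ D := Finset.sum_nonneg fun _ _ => hδ _
    have h3 : a * (3 * quarticRoot k ^ 3) ≤ a * (2 * quarticRoot (k + 1) ^ 3) :=
      mul_le_mul_of_nonneg_left (by linarith) ha
    have h4 : b * quarticRoot k ^ 3 * (A + D) ≤ b * quarticRoot (k + 1) ^ 3 * (A + D) :=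
      mul_le_mul_of_nonneg_right (mul_le_mul_of_nonneg_left (by linarith) hb) (add_nonneg hA hD)
    linarith

/-- The rounds `L, …, T` are covered by the consecutive intervals of length `L`, the last of which
is cut off at `T`. -/
theorem sum_Ico_eq_sum_blocks {L : ℕ} (hL : 0 < L) (T : ℕ) (h : ℕ → ℝ) :
    ∑ t ∈ Finset.Ico L (T + 1), h t =
      ∑ i ∈ Finset.Ico 1 (T / L + 1), ∑ t ∈ Finset.Ico (i * L) (min ((i + 1) * L) (T + 1)), h t := by
  have key : ∀ q, ∑ t ∈ Finset.Ico L (min ((q + 1) * L) (T + 1)), h t =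
      ∑ i ∈ Finset.Ico 1 (q + 1),
        ∑ t ∈ Finset.Ico (i * L) (min ((i + 1) * L) (T + 1)), h t := by
    intro q
    induction q with
    | zero => simp
    | succ q ih =>
      rw [Finset.sum_Ico_succ_top (by omega), ← ih]
      have e : (q + 1 + 1) * L = (q + 1) * L + L := Nat.succ_mul _ _
      have e' : (q + 1) * L = q * L + L := Nat.succ_mul _ _
      rcases le_or_gt ((q + 1) * L) (T + 1) with h1 | h1
      · rw [min_eq_left h1, Finset.sum_Ico_consecutive _ (by omega) (by omega)]
      · rw [Finset.Ico_eq_empty_of_le (by omega : min ((q + 1 + 1) * L) (T + 1) ≤ (q + 1) * L),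
          Finset.sum_empty, add_zero, min_eq_right h1.le, min_eq_right (by omega)]
  rw [← key, min_eq_right]
  have h1 := Nat.div_add_mod T L
  have h2 := Nat.mod_lt T hL
  rw [Nat.succ_mul, mul_comm]
  omega

/-- The choice of the interval length `2 ^ k ≈ T / p` that balances the two terms. -/
theorem exists_level_le {T : ℕ} {p a b S : ℝ} (ha : 0 ≤ a) (hb : 0 ≤ b) (hp : 1 ≤ p)
    (hS : S ≤ T)
    (H : ∀ k : ℕ, 2 ^ k ≤ T → S ≤ a * quarticRoot k ^ 3 * p + b * T / quarticRoot k) :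
    S ≤ (1 + a + 2 * b) * ((T : ℝ) ^ (3 / 4 : ℝ) * p ^ (1 / 4 : ℝ)) := by
  set θ := (T : ℝ) ^ (1 / 4 : ℝ) with hθ
  set π := p ^ (1 / 4 : ℝ) with hπ
  have hT0 : (0 : ℝ) ≤ T := Nat.cast_nonneg T
  have hθ4 : θ ^ 4 = T := by
    rw [hθ, ← Real.rpow_natCast, ← Real.rpow_mul hT0]; norm_num
  have hθ3 : (T : ℝ) ^ (3 / 4 : ℝ) = θ ^ 3 := by
    rw [hθ, ← Real.rpow_natCast, ← Real.rpow_mul hT0]; norm_num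
  have hπ4 : π ^ 4 = p := by
    rw [hπ, ← Real.rpow_natCast, ← Real.rpow_mul (by linarith)]; norm_num
  have hθ0 : 0 ≤ θ := Real.rpow_nonneg hT0 _
  have hπ1 : 1 ≤ π := Real.one_le_rpow hp (by norm_num)
  have hπ0 : 0 < π := by linarith
  have hprod : 0 ≤ θ ^ 3 * π := by positivity
  rw [hθ3]
  rcases lt_or_ge (T : ℝ) p with hTp | hpT
  · -- The comparators move by more than a constant per round: the trivial bound is good enough.
    have hle : θ ≤ π := by
      refine le_of_pow_le_pow_left₀ four_ne_zero hπ0.le ?_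
      rw [hθ4, hπ4]; exact hTp.le
    have h1 : (T : ℝ) ≤ θ ^ 3 * π := by
      rw [← hθ4, pow_succ]; gcongr
    have h2 : 0 ≤ (a + 2 * b) * (θ ^ 3 * π) := by positivity
    linarith
  · obtain ⟨k, hk1, hk2⟩ := exists_nat_pow_near ((one_le_div (by linarith)).2 hpT)
      (one_lt_two (α := ℝ))
    have hp0 : 0 < p := by linarith
    rw [le_div_iff₀ hp0] at hk1
    rw [div_lt_iff₀ hp0, pow_succ] at hk2
    have hkT : 2 ^ k ≤ T := by
      have : (2 : ℝ) ^ k ≤ T := le_trans (le_mul_of_one_le_right (by positivity) hp) hk1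
      exact_mod_cast this
    have h := H k hkT
    have hl4 := quarticRoot_pow_four k
    have hl0 := quarticRoot_pos k
    set l := quarticRoot k
    have h1 : l * π ≤ θ := by
      refine le_of_pow_le_pow_left₀ four_ne_zero hθ0 ?_
      rw [mul_pow, hl4, hπ4, hθ4]; exact hk1
    have h2 : θ ≤ 2 * (l * π) := by
      refine le_of_pow_le_pow_left₀ four_ne_zero (by positivity) ?_
      rw [mul_pow, mul_pow, hl4, hπ4, hθ4]
      have : 0 < (2 : ℝ) ^ k * p := by positivity
      linarith
    have h3 : a * l ^ 3 * p ≤ a * (θ ^ 3 * π) := by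
      calc a * l ^ 3 * p = a * ((l * π) ^ 3 * π) := by rw [← hπ4]; ring
        _ ≤ _ := by gcongr
    have h4 : b * T / l ≤ 2 * b * (θ ^ 3 * π) := by
      rw [div_le_iff₀ hl0, ← hθ4]
      calc b * θ ^ 4 = b * θ ^ 3 * θ := by ring
        _ ≤ b * θ ^ 3 * (2 * (l * π)) := by gcongr
        _ = _ := by ring
    linarith

section Combination

variable {E : Type*} [NormedAddCommGroup E] [InnerProductSpace ℝ E]

variable {K : Set E} {R G : ℝ} {O : ℝ → E → E → E × E} {B : ℕ → ℕ} {x₁ : ℕ × ℕ → E} {T : ℕ}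
  {f : ℕ → E → ℝ} {g : ℕ → E → E} {u : ℕ → E}

/-- The dynamic regret over an interval, cut off at round `τ`: that of its expert plus the regret
against the expert. -/
theorem interval_regret_le (hK : Convex ℝ K) (hKR : K ⊆ Metric.closedBall (0 : E) R)
    (hO : IsInfeasibleProjectionOracle K R O) (hB : IsBlockSize B) (hx₁ : ∀ I, x₁ I ∈ K)
    (hG : 0 ≤ G) (hg : ∀ t ∈ Finset.Icc 1 T, ∀ x ∈ K, ‖g t x‖ ≤ G)
    (hconv : ∀ t ∈ Finset.Icc 1 T, ∀ x ∈ K, ∀ y ∈ K, f t y ≥ f t x + inner ℝ (g t x) (y - x))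
    (hf : ∀ t ∈ Finset.Icc 1 T, ∀ x ∈ K, 0 ≤ f t x ∧ f t x ≤ 1) (hu : ∀ t, u t ∈ K)
    {τ k i : ℕ} (hτ : τ ≤ T) (hi : 1 ≤ i) (hs : i * 2 ^ k ≤ τ) :
    ∑ t ∈ Finset.Ico (i * 2 ^ k) (min ((i + 1) * 2 ^ k) (τ + 1)),
        (f t (action O B x₁ f g t) - f t (u t)) ≤
      3 * quarticRoot k ^ 3 +
      potential (metaState f (expertAction O B x₁ g) τ (k, i)).1
        (metaState f (expertAction O B x₁ g) τ (k, i)).2 / quarticRoot k ^ 3 +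
      (2 * R ^ 2 + 2 * R + 4 * G + G ^ 2 + 2) * quarticRoot k ^ 3 *
        (1 + ∑ t ∈ Finset.Ico (i * 2 ^ k) (min ((i + 1) * 2 ^ k) (τ + 1)), ‖u t - u (t + 1)‖) := by
  have hact := expertAction_mem hO B hx₁ g
  have h1 : 0 < 2 ^ k := by positivity
  have h2 : 0 < i * 2 ^ k := by positivity
  have h3 : (i + 1) * 2 ^ k = i * 2 ^ k + 2 ^ k := Nat.succ_mul _ _
  set n := min ((i + 1) * 2 ^ k) (τ + 1) - i * 2 ^ k with hn
  have hend : min ((i + 1) * 2 ^ k) (τ + 1) ≤ i * 2 ^ k + 2 ^ k := h3 ▸ min_le_left _ _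
  have hend' : min ((i + 1) * 2 ^ k) (τ + 1) ≤ τ + 1 := min_le_right _ _
  have hmem : ∀ j < n, i * 2 ^ k + j ∈ Finset.Icc 1 T := fun j hj =>
    Finset.mem_Icc.2 ⟨by omega, by omega⟩
  have hexp := expert_regret_le hO hKR hB hx₁ hG (f := f) (g := g) hu k i n (by omega)
    (fun j hj => hg _ (hmem j hj)) (fun j hj => hconv _ (hmem j hj)) (fun j hj => hf _ (hmem j hj))
  have hmeta := regret_le_potential (one_le_quarticRoot k)
    (metaState_fst_le_snd (f := f) (act := expertAction O B x₁ g) τ (k, i)).2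
    (by rw [quarticRoot_pow_four]; exact metaState_snd_le hK hact hf hτ k hi)
  have e : ∑ t ∈ Finset.Ico (i * 2 ^ k) (min ((i + 1) * 2 ^ k) (τ + 1)),
      (f t (action O B x₁ f g t) - f t (u t)) =
      (metaState f (expertAction O B x₁ g) τ (k, i)).1 + ∑ j ∈ Finset.range n,
        (f (i * 2 ^ k + j) (expertAction O B x₁ g (k, i) (i * 2 ^ k + j)) -
          f (i * 2 ^ k + j) (u (i * 2 ^ k + j))) := by
    rw [metaState_eq_sum τ k hi, ← Finset.sum_Ico_eq_sum_range
      (fun t => f t (expertAction O B x₁ g (k, i) t) - f t (u t)), ← Finset.sum_add_distrib]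
    refine Finset.sum_congr rfl fun t _ => ?_
    simp only [instantRegret, action]
    ring
  rw [e, Finset.sum_Ico_eq_sum_range (fun t => ‖u t - u (t + 1)‖)]
  linarith

/-- The regret in terms of an interval length `2 ^ k` that occurs in the analysis only. -/
theorem regret_le_of_level (hK : Convex ℝ K) (hKR : K ⊆ Metric.closedBall (0 : E) R)
    (hO : IsInfeasibleProjectionOracle K R O) (hB : IsBlockSize B) (hx₁ : ∀ I, x₁ I ∈ K)
    (hG : 0 ≤ G) (hg : ∀ t ∈ Finset.Icc 1 T, ∀ x ∈ K, ‖g t x‖ ≤ G)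
    (hconv : ∀ t ∈ Finset.Icc 1 T, ∀ x ∈ K, ∀ y ∈ K, f t y ≥ f t x + inner ℝ (g t x) (y - x))
    (hf : ∀ t ∈ Finset.Icc 1 T, ∀ x ∈ K, 0 ≤ f t x ∧ f t x ≤ 1) (hu : ∀ t, u t ∈ K)
    {k : ℕ} (hk : 2 ^ k ≤ T) {c : ℝ} (hc : c = 2 * R ^ 2 + 2 * R + 4 * G + G ^ 2 + 2) :
    ∑ t ∈ Finset.Ico 1 (T + 1), (f t (action O B x₁ f g t) - f t (u t)) ≤
      (104 + 2 * c) * quarticRoot k ^ 3 *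
        (1 + ∑ t ∈ Finset.Ico 1 (T + 1), ‖u t - u (t + 1)‖) +
      (28 + c) * T / quarticRoot k := by
  have hact := expertAction_mem hO B hx₁ g
  have hR0 : 0 ≤ R := by
    have := hKR (hu 0)
    exact (norm_nonneg _).trans (by simpa using this)
  have hc0 : 0 ≤ c := by rw [hc]; positivity
  set δ : ℕ → ℝ := fun t => ‖u t - u (t + 1)‖ with hδ
  set h : ℕ → ℝ := fun t => f t (action O B x₁ f g t) - f t (u t) with hh
  have hδ0 : ∀ t, 0 ≤ δ t := fun t => norm_nonneg _
  have hmain : ∀ {τ k i : ℕ}, τ ≤ T → 1 ≤ i → i * 2 ^ k ≤ τ →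
      ∑ t ∈ Finset.Ico (i * 2 ^ k) (min ((i + 1) * 2 ^ k) (τ + 1)), h t ≤
      3 * quarticRoot k ^ 3 +
      potential (metaState f (expertAction O B x₁ g) τ (k, i)).1
        (metaState f (expertAction O B x₁ g) τ (k, i)).2 / quarticRoot k ^ 3 +
      c * quarticRoot k ^ 3 *
        (1 + ∑ t ∈ Finset.Ico (i * 2 ^ k) (min ((i + 1) * 2 ^ k) (τ + 1)), δ t) := by
    rw [hc]
    exact fun h1 h2 h3 => interval_regret_le hK hKR hO hB hx₁ hG hg hconv hf hu h1 h2 h3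
  have hpot := fun {t : ℕ} (ht : t ≤ T) =>
    sum_potential_sub_one_le (f := f) hK hact hconv hf ht
  have hnn : ∀ (t : ℕ) (I : ℕ × ℕ), 0 ≤ potential (metaState f (expertAction O B x₁ g) t I).1
      (metaState f (expertAction O B x₁ g) t I).2 - 1 := fun t I =>
    sub_nonneg.2 (one_le_potential (metaState_fst_le_snd t I).1)
  have hkT : k < 2 ^ k := Nat.lt_two_pow_self
  -- The rounds before `2 ^ k`. At the end of the interval `[2 ^ j, 2 ^ (j + 1) - 1]` all potentials
  -- together are `O(2 ^ j)`.
  have hinit : ∑ t ∈ Finset.Ico 1 (2 ^ k), h t ≤ 2 * (52 + c) * quarticRoot k ^ 3 +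
      c * quarticRoot k ^ 3 * ∑ t ∈ Finset.Ico 1 (2 ^ k), δ t := by
    refine sum_Ico_one_two_pow_le (by linarith) hc0 hδ0 k fun j hj => ?_
    have hj1 : 1 ≤ 2 ^ j := Nat.one_le_two_pow
    have hj2 : 2 ^ (j + 1) = 2 * 2 ^ j := by ring
    have hjk : 2 ^ (j + 1) ≤ 2 ^ k := Nat.pow_le_pow_right (by norm_num) hj
    have hτ : 2 ^ (j + 1) - 1 ≤ T := by omega
    have hend : min ((1 + 1) * 2 ^ j) (2 ^ (j + 1) - 1 + 1) = 2 ^ (j + 1) := by omega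
    have hm := hmain (k := j) hτ le_rfl (by omega)
    rw [hend, one_mul] at hm
    have hΦ : potential (metaState f (expertAction O B x₁ g) (2 ^ (j + 1) - 1) (j, 1)).1
        (metaState f (expertAction O B x₁ g) (2 ^ (j + 1) - 1) (j, 1)).2 ≤
        49 * quarticRoot j ^ 4 := by
      have h1 := Finset.single_le_sum (fun I _ => hnn (2 ^ (j + 1) - 1) I)
        (show (j, 1) ∈ Finset.range (T + 1) ×ˢ Finset.Icc 1 T by
          simp only [Finset.mem_product, Finset.mem_range, Finset.mem_Icc]; omega)
      have h2 := hpot hτ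
      have h3 : ((2 ^ (j + 1) - 1 : ℕ) : ℝ) ≤ 2 * quarticRoot j ^ 4 := by
        rw [quarticRoot_pow_four]
        exact_mod_cast (by omega : 2 ^ (j + 1) - 1 ≤ 2 * 2 ^ j)
      have h4 : 1 ≤ quarticRoot j ^ 4 := one_le_pow₀ (one_le_quarticRoot j)
      linarith
    have hl1 := one_le_quarticRoot j
    have hl0 := quarticRoot_pos j
    have hΦ' : potential (metaState f (expertAction O B x₁ g) (2 ^ (j + 1) - 1) (j, 1)).1
        (metaState f (expertAction O B x₁ g) (2 ^ (j + 1) - 1) (j, 1)).2 / quarticRoot j ^ 3 ≤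
        49 * quarticRoot j ^ 3 := by
      rw [div_le_iff₀ (by positivity)]
      refine hΦ.trans ?_
      rw [mul_assoc, ← pow_add]
      gcongr
      norm_num
    linarith
  -- The rounds from `2 ^ k` on: only the sum of the potentials over level `k` is under control.
  have hrest : ∑ t ∈ Finset.Ico (2 ^ k) (T + 1), h t ≤ (28 + c) * T / quarticRoot k +
      c * quarticRoot k ^ 3 * ∑ t ∈ Finset.Ico (2 ^ k) (T + 1), δ t := by
    have hl1 := one_le_quarticRoot k
    have hl0 := quarticRoot_pos k
    have hl4 := quarticRoot_pow_four k
    rw [sum_Ico_eq_sum_blocks (pow_pos two_pos k) T h, sum_Ico_eq_sum_blocks (pow_pos two_pos k) T δ]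
    set q := T / 2 ^ k with hq
    set l := quarticRoot k
    have hqT : (q : ℝ) ≤ T / l ^ 4 := by
      rw [hl4]; exact Nat.cast_div_le.trans (by simp)
    set Φ : ℕ → ℝ := fun i => potential (metaState f (expertAction O B x₁ g) T (k, i)).1
        (metaState f (expertAction O B x₁ g) T (k, i)).2
    have hΦ : ∑ i ∈ Finset.Ico 1 (q + 1), (Φ i - 1) ≤ 24 * T := by
      refine le_trans ?_ (hpot le_rfl)
      rw [Finset.sum_product]
      refine le_trans ?_ (Finset.single_le_sum
        (f := fun k => ∑ i ∈ Finset.Icc 1 T,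
          (potential (metaState f (expertAction O B x₁ g) T (k, i)).1
            (metaState f (expertAction O B x₁ g) T (k, i)).2 - 1))
        (fun k _ => Finset.sum_nonneg fun i _ => hnn T (k, i))
        (Finset.mem_range.2 (by omega : k < T + 1)))
      refine Finset.sum_le_sum_of_subset_of_nonneg ?_ fun i _ _ => hnn T (k, i)
      have : q ≤ T := Nat.div_le_self _ _
      intro i hi
      rw [Finset.mem_Ico] at hi
      exact Finset.mem_Icc.2 (by omega)
    calc _ ≤ ∑ i ∈ Finset.Ico 1 (q + 1), ((3 * l ^ 3 + 1 / l ^ 3 + c * l ^ 3) + (Φ i - 1) / l ^ 3 +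
          c * l ^ 3 * ∑ t ∈ Finset.Ico (i * 2 ^ k) (min ((i + 1) * 2 ^ k) (T + 1)), δ t) := by
          refine Finset.sum_le_sum fun i hi => ?_
          rw [Finset.mem_Ico] at hi
          have := hmain (k := k) (i := i) le_rfl hi.1
            ((Nat.le_div_iff_mul_le (by positivity)).1 (by omega))
          have e : Φ i / l ^ 3 = 1 / l ^ 3 + (Φ i - 1) / l ^ 3 := by ring
          linarith
      _ = q * (3 * l ^ 3 + 1 / l ^ 3 + c * l ^ 3) + (∑ i ∈ Finset.Ico 1 (q + 1), (Φ i - 1)) / l ^ 3 +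
          c * l ^ 3 * ∑ i ∈ Finset.Ico 1 (q + 1),
            ∑ t ∈ Finset.Ico (i * 2 ^ k) (min ((i + 1) * 2 ^ k) (T + 1)), δ t := by
          rw [Finset.sum_add_distrib, Finset.sum_add_distrib, Finset.sum_div, Finset.mul_sum,
            Finset.sum_const, Nat.card_Ico, nsmul_eq_mul, Nat.add_sub_cancel]
      _ ≤ _ := by
          have h3 : 1 ≤ l ^ 3 := one_le_pow₀ hl1
          have h4 : 1 / l ^ 3 ≤ l ^ 3 := (div_le_one (by positivity)).2 h3 |>.trans h3
          have h5 : (q : ℝ) * (3 * l ^ 3 + 1 / l ^ 3 + c * l ^ 3) ≤ (4 + c) * T / l := by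
            calc _ ≤ (T / l ^ 4) * (3 * l ^ 3 + l ^ 3 + c * l ^ 3) := by gcongr
              _ = _ := by field_simp; ring
          have h6 : (∑ i ∈ Finset.Ico 1 (q + 1), (Φ i - 1)) / l ^ 3 ≤ 24 * T / l := by
            have : l ≤ l ^ 3 := le_self_pow₀ hl1 (by norm_num)
            calc _ ≤ 24 * T / l ^ 3 := by gcongr
              _ ≤ _ := by gcongr
          have e : (28 + c) * T / l = (4 + c) * T / l + 24 * T / l := by ring
          linarith
  have h1 : 1 ≤ 2 ^ k := Nat.one_le_two_pow
  rw [← Finset.sum_Ico_consecutive h h1 (by omega : 2 ^ k ≤ T + 1),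
    ← Finset.sum_Ico_consecutive δ h1 (by omega : 2 ^ k ≤ T + 1)]
  set A := ∑ t ∈ Finset.Ico 1 (2 ^ k), δ t
  set D := ∑ t ∈ Finset.Ico (2 ^ k) (T + 1), δ t
  have hA : 0 ≤ A := Finset.sum_nonneg fun _ _ => hδ0 _
  have hD : 0 ≤ D := Finset.sum_nonneg fun _ _ => hδ0 _
  have hl3 : 0 < quarticRoot k ^ 3 := by have := quarticRoot_pos k; positivity
  have : 0 ≤ (104 + c) * quarticRoot k ^ 3 * (A + D) := by positivity
  linarith

end Combination

end POLA

theorem theorem4 (R G : ℝ) :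
    ∃ c : ℝ, ∀ (d : ℕ) (K : Set (EuclideanSpace ℝ (Fin d))),
      -- the decision set: convex, contains the origin, lies in the ball of radius `R`
      Convex ℝ K → (0 : EuclideanSpace ℝ (Fin d)) ∈ K →
      K ⊆ Metric.closedBall (0 : EuclideanSpace ℝ (Fin d)) R →
      -- the oracle, the block sizes and the initial points that the algorithm uses
      ∀ O : ℝ → EuclideanSpace ℝ (Fin d) → EuclideanSpace ℝ (Fin d) →
          EuclideanSpace ℝ (Fin d) × EuclideanSpace ℝ (Fin d),
      POLA.IsInfeasibleProjectionOracle K R O →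
      ∀ B : ℕ → ℕ, POLA.IsBlockSize B →
      ∀ x₁ : ℕ × ℕ → EuclideanSpace ℝ (Fin d), (∀ I, x₁ I ∈ K) →
      -- the losses `f t` and their gradients `f' t x` at the points `x` of `K`
      ∀ (T : ℕ) (f : ℕ → EuclideanSpace ℝ (Fin d) → ℝ)
        (f' : ℕ → EuclideanSpace ℝ (Fin d) → EuclideanSpace ℝ (Fin d)),
      (∀ t ∈ Finset.Icc 1 T, ∀ x ∈ K, HasGradientWithinAt (f t) (f' t x) K x) →
      -- a condition on the component of the gradient that `f t` on `K` does not determine;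
      -- it holds automatically if `K` has an interior point
      (∀ t ∈ Finset.Icc 1 T, ∀ x ∈ K, f' t x ∈ Submodule.span ℝ K ∨ ‖f' t x‖ ≤ G) →
      -- Lipschitz continuity, convexity and boundedness over `K`
      (∀ t ∈ Finset.Icc 1 T, ∀ x ∈ K, ∀ y ∈ K, |f t x - f t y| ≤ G * ‖x - y‖) →
      (∀ t ∈ Finset.Icc 1 T, ∀ x ∈ K, ∀ y ∈ K,
        f t y ≥ f t x + inner ℝ (f' t x) (y - x)) →
      (∀ t ∈ Finset.Icc 1 T, ∀ x ∈ K, 0 ≤ f t x ∧ f t x ≤ 1) →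
      -- the comparators
      ∀ u : ℕ → EuclideanSpace ℝ (Fin d), (∀ t ∈ Finset.Icc 1 T, u t ∈ K) →
        POLA.dynamicRegret f (POLA.action O B x₁ f f') u T ≤
          c * ((T : ℝ) ^ (3 / 4 : ℝ) * (1 + POLA.pathLength u T) ^ (1 / 4 : ℝ)) := by
  set G' := max G 0
  set C := 2 * R ^ 2 + 2 * R + 4 * G' + G' ^ 2 + 2 with hC
  refine ⟨1 + (104 + 2 * C) + 2 * (28 + C), ?_⟩
  intro d K hK h0 hKR O hO B hB x₁ hx₁ T f f' hgrad hspan hlip hconv hf u hu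
  have hR0 : 0 ≤ R := by simpa using hKR h0
  have hG0 : 0 ≤ G' := le_max_right _ _
  have hC0 : 0 ≤ C := by positivity
  have hg : ∀ t ∈ Finset.Icc 1 T, ∀ x ∈ K, ‖f' t x‖ ≤ G' := fun t ht x hx =>
    POLA.norm_gradient_le hK h0 hx (hgrad t ht x hx) (hlip t ht) (hspan t ht x hx)
  have hact := POLA.expertAction_mem hO B hx₁ f'
  have hregret : POLA.dynamicRegret f (POLA.action O B x₁ f f') u T =
      ∑ t ∈ Finset.Ico 1 (T + 1), (f t (POLA.action O B x₁ f f' t) - f t (u t)) := by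
    rw [POLA.dynamicRegret, ← Finset.sum_sub_distrib, Finset.Ico_add_one_right_eq_Icc]
  have hpath0 : 0 ≤ POLA.pathLength u T := Finset.sum_nonneg fun _ _ => norm_nonneg _
  refine POLA.exists_level_le (by linarith) (by linarith) (by linarith) ?_ fun k hk => ?_
  · rw [hregret]
    calc _ ≤ ∑ t ∈ Finset.Ico 1 (T + 1), (1 : ℝ) := by
          refine Finset.sum_le_sum fun t ht => ?_
          rw [Finset.Ico_add_one_right_eq_Icc] at ht
          obtain ⟨s, rfl⟩ := Nat.exists_eq_add_of_le' (Finset.mem_Icc.1 ht).1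
          have h1 := (hf _ ht _ (POLA.weightedAction_mem (f := f) hK hact s)).2
          have h2 := (hf _ ht _ (hu _ ht)).1
          have e : POLA.action O B x₁ f f' (s + 1) = POLA.weightedAction
            (POLA.expertAction O B x₁ f')
            (POLA.metaState f (POLA.expertAction O B x₁ f') s) (s + 1) := rfl
          rw [e]
          linarith
      _ = T := by simp
  · have hT : 1 ≤ T := Nat.one_le_two_pow.trans hk
    -- Outside of the rounds `1, …, T` the comparators may lie anywhere; freeze them there.
    set v : ℕ → EuclideanSpace ℝ (Fin d) := fun t => u (max 1 (min t T)) with hv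
    have hvu : ∀ t ∈ Finset.Icc 1 T, v t = u t := fun t ht => by
      rw [Finset.mem_Icc] at ht
      simp only [hv]
      congr 1
      omega
    have hpath : POLA.pathLength u T = ∑ t ∈ Finset.Ico 1 (T + 1), ‖v t - v (t + 1)‖ := by
      have hlast : v T = v (T + 1) := by simp only [hv]; congr 1; omega
      rw [Finset.sum_Ico_succ_top hT, hlast, sub_self, norm_zero, add_zero, POLA.pathLength,
        ← Finset.Ico_add_one_right_eq_Icc, ← Finset.sum_Ico_add' _ 1 T 1]
      refine Finset.sum_congr rfl fun t ht => ?_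
      rw [Finset.mem_Ico] at ht
      rw [hvu t (Finset.mem_Icc.2 (by omega)), hvu (t + 1) (Finset.mem_Icc.2 (by omega)),
        Nat.add_sub_cancel]
    have h := POLA.regret_le_of_level (u := v) hK hKR hO hB hx₁ hG0 hg hconv hf
      (fun t => hu _ (Finset.mem_Icc.2 (by omega))) hk hC
    rw [hregret, hpath]
    refine le_trans (le_of_eq (Finset.sum_congr rfl fun t ht => ?_)) h
    rw [Finset.Ico_add_one_right_eq_Icc] at ht
    rw [hvu t ht]
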